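/- Let $H$ be a real Hilbert space, let $g:H\to(-\infty,+\infty]$ be proper, lower semicontinuous and convex ($g\in\Gamma_0(H)$), let $\beta>0$, and let $f:H\to\mathbb R$ be convex and differentiable with $\frac1\beta$-Lipschitz continuous gradient. Let $\Omega$ be the set of minimizers of $f+g$ over $H$, and assume $\Omega\neq\emptyset$. For bounded self-adjoint operators $U,V$ on $H$ write $U\succeq V$ if $\langle Ux,x\rangle\ge\langle Vx,x\rangle$ for all $x\in H$; let $\mathcal P_\alpha(H)$ be the set of bounded self-adjoint $U$ with $U\succeq\alpha I$, and put $\|x\|_U=\sqrt{\langle Ux,x\rangle}$. For $U\in\mathcal P_\alpha(H)$ with $\alpha>0$, $\gamma>0$ and $x\in H$, let $\mathrm{prox}^{U^{-1}}_{\gamma g}(x)$ be the minimizer of $y\mapsto\frac12\|x-y\|_{U^{-1}}^2+\gamma g(y)$ over $H$. Let $\alpha>0$, let $(\eta_k)_{k\ge0}$ be a summable sequence in $[0,+\infty)$, and let $(U_k)_{k\ge0}$ be a sequence in $\mathcal P_\alpha(H)$ such that $$\mu:=\sup_k\|U_k\|<+\infty,\qquad (1+\eta_k)U_{k+1}\succeq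 U_k\quad\text{for all }k\ge 0.$$ Let $\gamma_k>0$ with $\gamma_k\|U_k\|<2\beta$, put $\alpha_k=\frac{2\beta}{4\beta-\gamma_k\|U_k\|}$, let $\lambda_k\in(0,\frac1{\alpha_k})$, and let $(a_k),(b_k)$ be sequences in $H$ with $\sum_k\lambda_k\|a_k\|<+\infty$ and $\sum_k\lambda_k\|b_k\|<+\infty$. Let $x_0\in H$ and, for $k\ge0$, $$y_k=x_k-\gamma_kU_k(\nabla f(x_k)+b_k),\qquad x_{k+1}=x_k+\lambda_k\bigl(\mathrm{prox}^{U_k^{-1}}_{\gamma_kg}(y_k)+a_k-x_k\bigr).$$ Consider the following statements: (i) for every $x^*\in\Omega$, $\lim_{k\to\infty}\|x_k-x^*\|_{U_k^{-1}}$ exists (in $\mathbb R$); (ii) $\lim_{k\to\infty}\bigl\|x_k-\mathrm{prox}^{U_k^{-1}}_{\gamma_kg}(x_k-\gamma_kU_k\nabla f(x_k))\bigr\|=0$; (iii) $(x_k)$ converges weakly to a point of $\Omega$; (iv) $\nabla f(x_k)\to\nabla f(x^*)$ strongly, for every $x^*\in\Omega$. Then (i) holds. Moreover: **(A)** Suppose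 that there are $\underline\lambda>0$ and $\tau>0$ with $\underline\lambda\le\lambda_k\le\frac1{\alpha_k}-\tau$ for all $k$. Then (ii) holds. If in addition there is $\underline\gamma>0$ with $\underline\gamma\le\gamma_k$ for all $k$, then (iii) holds. If furthermore there is $\varepsilon>0$ with $\gamma_k\mu\le2\beta-\varepsilon$ for all $k$, then (iv) holds. **(B)** Suppose instead that $\sum_k\lambda_k\bigl(\frac1{\alpha_k}-\lambda_k\bigr)=+\infty$; that there are $\underline\gamma>0$ and $\varepsilon>0$ with $\underline\gamma\le\gamma_k$ and $\gamma_k\mu\le2\beta-\varepsilon$ for all $k$; and that $\sum_k|\gamma_{k+1}-\gamma_k|<+\infty$, $\sum_k\bigl|\gamma_{k+1}\|U_{k+1}\|-\gamma_k\|U_k\|\bigr|<+\infty$, and $\sum_k\|U_k^{-1}x-U_{k+1}^{-1}x\|<+\infty$ for every $x\in H$. Then (ii) and (iii) hold. If in addition there is $\underline\lambda>0$ with $\underline\lambda\le\lambda_k$ for all $k$, then (iv) holds. -/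

import Mathlib

open Filter Topology

noncomputable section

namespace VMFB

variable {H : Type*} [NormedAddCommGroup H] [InnerProductSpace ℝ H]

/-- `g ∈ Γ₀(H)`: proper, lower semicontinuous, convex, with values in `(-∞, +∞]`.
In `EReal` one has `0 * ⊤ = 0`, so the weights `0` and `1` make the convexity inequality trivial. -/
structure IsGammaZero (g : H → EReal) : Prop where
  ne_bot : ∀ x, g x ≠ ⊥
  exists_ne_top : ∃ x, g x ≠ ⊤
  lsc : LowerSemicontinuous g
  convex : ∀ x y : H, ∀ s t : ℝ, 0 ≤ s → 0 ≤ t → s + t = 1 →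
    g (s • x + t • y) ≤ (s : EReal) * g x + (t : EReal) * g y

/-- The set of minimizers of `f + g` over `H`. -/
def solutionSet (f : H → ℝ) (g : H → EReal) : Set H :=
  {x | ∀ y : H, (f x : EReal) + g x ≤ (f y : EReal) + g y}

/-- `U ∈ 𝒫_α(H)`: bounded, self-adjoint, and `U ≽ α I` in the Loewner order. -/
def IsPAlpha [CompleteSpace H] (α : ℝ) (U : H →L[ℝ] H) : Prop :=
  IsSelfAdjoint U ∧ α • ContinuousLinearMap.id ℝ H ≤ U

/-- The (semi-)norm `‖x‖_W = √⟨W x, x⟩`. -/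
def metricNorm (W : H →L[ℝ] H) (x : H) : ℝ :=
  Real.sqrt (inner ℝ (W x) x)

/-- The proximity operator of `h` relative to the metric of `W`: `prox W h x` is the minimizer of
`y ↦ (1/2) ‖x - y‖_W² + h y` (which exists and is unique when `h ∈ Γ₀(H)` and `W ∈ 𝒫_α(H)`, `α > 0`;
it is an arbitrary point if no minimizer exists). -/
def prox (W : H →L[ℝ] H) (h : H → EReal) (x : H) : H :=
  @Classical.epsilon H ⟨x⟩ fun p => ∀ y : H,
    ((1 / 2 * metricNorm W (x - p) ^ 2 : ℝ) : EReal) + h p ≤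
      ((1 / 2 * metricNorm W (x - y) ^ 2 : ℝ) : EReal) + h y

/-- `prox_{γ g}^{U⁻¹}`. Here `Ring.inverse U` is the inverse of `U` as a bounded operator; every
`U ∈ 𝒫_α(H)` with `α > 0` is invertible, see `IsPAlpha.isUnit`. -/
def proxInv (U : H →L[ℝ] H) (γ : ℝ) (g : H → EReal) (x : H) : H :=
  prox (Ring.inverse U) (fun y => (γ : EReal) * g y) x

/-- The constant `α_k = 2β / (4β - γ_k ‖U_k‖)`. -/
def avgConst (β γ : ℝ) (U : H →L[ℝ] H) : ℝ :=
  2 * β / (4 * β - γ * ‖U‖)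

theorem IsPAlpha.isUnit [CompleteSpace H] {α : ℝ} (hα : 0 < α) {U : H →L[ℝ] H}
    (hU : IsPAlpha α U) : IsUnit U := by
  refine ContinuousLinearMap.isUnit_of_forall_le_norm_inner_map U (c := ⟨α, hα.le⟩) hα ?_
  intro x
  have h := ((ContinuousLinearMap.le_def _ _).1 hU.2).inner_nonneg_left x
  have h1 : α * ‖x‖ ^ 2 ≤ inner ℝ (U x) x := by
    have h2 : inner ℝ ((U - α • ContinuousLinearMap.id ℝ H) x) x
        = inner ℝ (U x) x - α * ‖x‖ ^ 2 := by
      simp [inner_sub_left, inner_smul_left]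
    rw [h2] at h
    linarith
  calc ‖x‖ ^ 2 * α = α * ‖x‖ ^ 2 := mul_comm _ _
    _ ≤ inner ℝ (U x) x := h1
    _ ≤ ‖inner ℝ (U x) x‖ := Real.le_norm_self _

end VMFB

end

namespace VMFB

/-! ### Growth factors built from summable sequences. -/

section Products

/-! Write `M = U⁻¹`, `ω = ‖U‖`, let `r` be the forward-backward residual at `x`, and put `d = x -
z`, `b = ∇f x - ∇f z` for a minimizer `z`. The identity `excess_eq` writes `X = ⟨Mr, d⟩ - (1 -
γω/(4β))⟨Mr, r⟩` as a sum of four terms, nonnegative by monotonicity of `∂g`, cocoercivity of `∇f`,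
positivity of a square, and `‖r‖² ≤ ω⟨Mr, r⟩`. A relaxed step therefore decreases `‖x - z‖²_M` by
exactly `λ(2X + (1/α_k - λ)‖r‖²_M)`. Adding the errors and the change of metric makes the iterates
quasi-Fejér monotone: distances converge, which is (i), and the decrements are summable.

In (A) the factor `λ(1/α_k - λ)` is bounded below, so `r → 0`. In (B) the summable quantity used is
`λX`, and the divergence hypothesis serves to give `∑ λ = ∞`. If `X` is small, each of the four
terms is small, and when `γω ≤ 2β - ε` this forces `r` to be small (`residual_sq_le`). Hence only a
finite total step length is spent where the residual is large. As residuals at any two indices are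
comparable up to the distance of the iterates, `r → 0` (`tendsto_zero_of_summable_excursions`).

For (iii), the metrics `U_k⁻¹` are decreasing up to summable factors and so converge strongly. A
variable metric Opial lemma then reduces weak convergence to showing that weak cluster points are
minimizers, which follows from `r → 0` and weak closedness of closed convex level sets. For (iv),
monotonicity and cocoercivity give `β‖b‖² = O(‖r‖)`. -/

theorem exists_growth_factor {η : ℕ → ℝ} (hη : ∀ k, 0 ≤ η k) (hs : Summable η) :
    ∃ P : ℕ → ℝ, (∀ k, 1 ≤ P k) ∧ (∀ k, P (k + 1) = (1 + η k) * P k) ∧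
      ∃ L, Tendsto P atTop (𝓝 L) := by
  refine ⟨fun k => ∏ j ∈ Finset.range k, (1 + η j), fun k => ?_, fun k => ?_, ?_⟩
  · induction k with
    | zero => simp
    | succ k ih =>
      simp only [Finset.prod_range_succ] at ih ⊢
      nlinarith [hη k]
  · simp only
    rw [Finset.prod_range_succ, mul_comm]
  · refine ⟨_, tendsto_atTop_ciSup (monotone_nat_of_le_succ fun k => ?_)
      ⟨Real.exp (∑' j, η j), ?_⟩⟩
    · rw [Finset.prod_range_succ]
      have : 0 ≤ ∏ j ∈ Finset.range k, (1 + η j) :=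
        Finset.prod_nonneg fun j _ => by linarith [hη j]
      nlinarith [hη k]
    · rintro _ ⟨k, rfl⟩
      exact (Real.prod_one_add_le_exp_sum _ hη).trans
        (Real.exp_le_exp.2 (hs.sum_le_tsum _ fun j _ => hη j))

end Products

/-! ### Positive operators, inverse metrics and their strong limits. -/

section Operators

variable {H : Type*} [NormedAddCommGroup H] [InnerProductSpace ℝ H]

/-- Cauchy–Schwarz for a positive symmetric operator. -/
theorem inner_sq_le_of_nonneg {A : H →L[ℝ] H} (hs : ∀ x y, inner ℝ (A x) y = inner ℝ x (A y))
    (hA : ∀ x, 0 ≤ inner ℝ (A x) x) (x y : H) :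
    inner ℝ (A x) y ^ 2 ≤ inner ℝ (A x) x * inner ℝ (A y) y := by
  have key : ∀ t : ℝ, 0 ≤ inner ℝ (A y) y * (t * t) + 2 * inner ℝ (A x) y * t
      + inner ℝ (A x) x := by
    intro t
    have h := hA (x + t • y)
    have e : inner ℝ (A (x + t • y)) (x + t • y) = inner ℝ (A y) y * (t * t)
        + 2 * inner ℝ (A x) y * t + inner ℝ (A x) x := by
      have : inner ℝ (A y) x = inner ℝ (A x) y := by rw [hs, real_inner_comm]
      simp only [map_add, map_smul, inner_add_left, inner_add_right, inner_smul_left,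
        inner_smul_right, this, RCLike.conj_to_real]
      ring
    linarith
  have h := discrim_le_zero key
  rw [discrim] at h
  nlinarith

/-- Cauchy–Schwarz for `A` at the pair `x`, `A x`, followed by cancelling `‖A x‖²`. It upgrades
control of a quadratic form to control in norm. -/
theorem norm_sq_le_of_nonneg {A : H →L[ℝ] H} (hs : ∀ x y, inner ℝ (A x) y = inner ℝ x (A y))
    (hA : ∀ x, 0 ≤ inner ℝ (A x) x) {C : ℝ} (hC : ∀ x, inner ℝ (A x) x ≤ C * ‖x‖ ^ 2) (x : H) :
    ‖A x‖ ^ 2 ≤ C * inner ℝ (A x) x := by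
  have h := inner_sq_le_of_nonneg hs hA x (A x)
  rw [real_inner_self_eq_norm_sq] at h
  have h2 := mul_le_mul_of_nonneg_left (hC (A x)) (hA x)
  rcases (norm_nonneg (A x)).eq_or_lt with h0 | h0
  · have : A x = 0 := by simpa using h0.symm
    simp [this]
  · have h3 : (‖A x‖ ^ 2) * ‖A x‖ ^ 2 ≤ (C * inner ℝ (A x) x) * ‖A x‖ ^ 2 := by nlinarith
    exact le_of_mul_le_mul_right h3 (by positivity)

/-- `M` is symmetric with `c ‖x‖² ≤ ⟨M x, x⟩` for some `c > 0`. -/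
structure IsMetric (M : H →L[ℝ] H) : Prop where
  symm : ∀ x y, inner ℝ (M x) y = inner ℝ x (M y)
  coercive : ∃ c : ℝ, 0 < c ∧ ∀ x, c * ‖x‖ ^ 2 ≤ inner ℝ (M x) x

theorem IsMetric.nonneg {M : H →L[ℝ] H} (hM : IsMetric M) (x : H) : 0 ≤ inner ℝ (M x) x := by
  obtain ⟨c, hc, h⟩ := hM.coercive
  exact le_trans (by positivity) (h x)

theorem IsMetric.metricNorm_sq {M : H →L[ℝ] H} (hM : IsMetric M) (x : H) :
    metricNorm M x ^ 2 = inner ℝ (M x) x :=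
  Real.sq_sqrt (hM.nonneg x)

theorem metricNorm_nonneg (M : H →L[ℝ] H) (x : H) : 0 ≤ metricNorm M x := Real.sqrt_nonneg _

theorem IsMetric.inner_comm {M : H →L[ℝ] H} (hM : IsMetric M) (x y : H) :
    inner ℝ (M x) y = inner ℝ (M y) x := by
  rw [hM.symm, real_inner_comm]

theorem IsMetric.inner_le {M : H →L[ℝ] H} (hM : IsMetric M) (x y : H) :
    inner ℝ (M x) y ≤ metricNorm M x * metricNorm M y := by
  refine (abs_le_of_sq_le_sq' ?_ (mul_nonneg (metricNorm_nonneg M x) (metricNorm_nonneg M y))).2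
  rw [mul_pow, hM.metricNorm_sq, hM.metricNorm_sq]
  exact inner_sq_le_of_nonneg hM.symm hM.nonneg x y

theorem IsMetric.inner_add_self {M : H →L[ℝ] H} (hM : IsMetric M) (x y : H) :
    inner ℝ (M (x + y)) (x + y) =
      inner ℝ (M x) x + 2 * inner ℝ (M x) y + inner ℝ (M y) y := by
  simp only [map_add, inner_add_left, inner_add_right, hM.inner_comm y x]
  ring

theorem IsMetric.metricNorm_add_le {M : H →L[ℝ] H} (hM : IsMetric M) (x y : H) :
    metricNorm M (x + y) ≤ metricNorm M x + metricNorm M y := by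
  refine (abs_le_of_sq_le_sq' ?_ (add_nonneg (metricNorm_nonneg M x) (metricNorm_nonneg M y))).2
  rw [hM.metricNorm_sq, hM.inner_add_self, ← hM.metricNorm_sq, ← hM.metricNorm_sq y]
  nlinarith [hM.inner_le x y]

theorem inner_apply_self_le (U : H →L[ℝ] H) (x : H) : inner ℝ (U x) x ≤ ‖U‖ * ‖x‖ ^ 2 := by
  calc inner ℝ (U x) x ≤ ‖U x‖ * ‖x‖ := real_inner_le_norm _ _
    _ ≤ ‖U‖ * ‖x‖ * ‖x‖ := by gcongr; exact U.le_opNorm x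
    _ = _ := by ring

variable [CompleteSpace H]

theorem IsPAlpha.mul_norm_sq_le {α : ℝ} {U : H →L[ℝ] H} (hU : IsPAlpha α U) (x : H) :
    α * ‖x‖ ^ 2 ≤ inner ℝ (U x) x := by
  have h := ((ContinuousLinearMap.le_def _ _).1 hU.2).inner_nonneg_left x
  have h2 : inner ℝ ((U - α • ContinuousLinearMap.id ℝ H) x) x
      = inner ℝ (U x) x - α * ‖x‖ ^ 2 := by
    simp [inner_sub_left, inner_smul_left]
  linarith

theorem IsPAlpha.symm {α : ℝ} {U : H →L[ℝ] H} (hU : IsPAlpha α U) (x y : H) :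
    inner ℝ (U x) y = inner ℝ x (U y) :=
  hU.1.isSymmetric x y

theorem IsPAlpha.isMetric {α : ℝ} (hα : 0 < α) {U : H →L[ℝ] H} (hU : IsPAlpha α U) :
    IsMetric U :=
  ⟨hU.symm, α, hα, hU.mul_norm_sq_le⟩

theorem IsPAlpha.apply_inverse {α : ℝ} (hα : 0 < α) {U : H →L[ℝ] H} (hU : IsPAlpha α U) (x : H) :
    U (Ring.inverse U x) = x :=
  congrArg (fun T : H →L[ℝ] H => T x) (Ring.mul_inverse_cancel U (hU.isUnit hα))

theorem IsPAlpha.inverse_apply {α : ℝ} (hα : 0 < α) {U : H →L[ℝ] H} (hU : IsPAlpha α U) (x : H) :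
    Ring.inverse U (U x) = x :=
  congrArg (fun T : H →L[ℝ] H => T x) (Ring.inverse_mul_cancel U (hU.isUnit hα))

theorem IsPAlpha.norm_sq_le {α : ℝ} (hα : 0 < α) {U : H →L[ℝ] H} (hU : IsPAlpha α U) (x : H) :
    ‖x‖ ^ 2 ≤ ‖U‖ * inner ℝ (Ring.inverse U x) x := by
  have h := norm_sq_le_of_nonneg hU.symm (hU.isMetric hα).nonneg (inner_apply_self_le U)
    (Ring.inverse U x)
  rwa [hU.apply_inverse hα, real_inner_comm] at h

theorem IsPAlpha.norm_inverse_le {α : ℝ} (hα : 0 < α) {U : H →L[ℝ] H} (hU : IsPAlpha α U)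
    (x : H) : ‖Ring.inverse U x‖ ≤ ‖x‖ / α := by
  have h := hU.mul_norm_sq_le (Ring.inverse U x)
  rw [hU.apply_inverse hα] at h
  have h2 := real_inner_le_norm x (Ring.inverse U x)
  rw [le_div_iff₀ hα]
  rcases (norm_nonneg (Ring.inverse U x)).eq_or_lt with h0 | h0
  · rw [← h0]; simp
  · exact le_of_mul_le_mul_right (by nlinarith) h0

theorem IsPAlpha.inner_inverse_le {α : ℝ} (hα : 0 < α) {U : H →L[ℝ] H} (hU : IsPAlpha α U)
    (x y : H) : inner ℝ (Ring.inverse U x) y ≤ ‖x‖ * ‖y‖ / α := by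
  calc _ ≤ ‖Ring.inverse U x‖ * ‖y‖ := real_inner_le_norm _ _
    _ ≤ ‖x‖ / α * ‖y‖ := by gcongr; exact hU.norm_inverse_le hα x
    _ = _ := by ring

theorem IsPAlpha.inverse_symm {α : ℝ} (hα : 0 < α) {U : H →L[ℝ] H} (hU : IsPAlpha α U)
    (x y : H) : inner ℝ (Ring.inverse U x) y = inner ℝ x (Ring.inverse U y) := by
  have h := hU.symm (Ring.inverse U x) (Ring.inverse U y)
  rw [hU.apply_inverse hα, hU.apply_inverse hα] at h
  exact h.symm

theorem IsPAlpha.inverse_isMetric {α : ℝ} (hα : 0 < α) {U : H →L[ℝ] H} (hU : IsPAlpha α U) :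
    IsMetric (Ring.inverse U) := by
  refine ⟨hU.inverse_symm hα, (‖U‖ + 1)⁻¹, by positivity, fun x => ?_⟩
  rw [inv_mul_le_iff₀ (by positivity)]
  have h := hU.norm_sq_le hα x
  have h0 : 0 ≤ inner ℝ (Ring.inverse U x) x := by
    have := (hU.isMetric hα).nonneg (Ring.inverse U x)
    rwa [hU.apply_inverse hα, real_inner_comm] at this
  nlinarith

/-- `‖U‖ U⁻¹ - I` is positive with quadratic form at most `‖U‖/α`, so a small gap in `‖x‖² ≤
‖U‖⟨U⁻¹x, x⟩` means that `‖U‖ U⁻¹ x` is close to `x`. -/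
theorem IsPAlpha.norm_sub_sq_le {α : ℝ} (hα : 0 < α) {U : H →L[ℝ] H} (hU : IsPAlpha α U)
    (x : H) : ‖‖U‖ • Ring.inverse U x - x‖ ^ 2 ≤
      ‖U‖ / α * (‖U‖ * inner ℝ (Ring.inverse U x) x - ‖x‖ ^ 2) := by
  have e : ∀ x, inner ℝ ((‖U‖ • Ring.inverse U - ContinuousLinearMap.id ℝ H) x) x
      = ‖U‖ * inner ℝ (Ring.inverse U x) x - ‖x‖ ^ 2 := by
    intro x
    simp [inner_sub_left, inner_smul_left]
  have h := norm_sq_le_of_nonneg (A := ‖U‖ • Ring.inverse U - ContinuousLinearMap.id ℝ H)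
    (fun x y => by
      simp [inner_sub_left, inner_sub_right, inner_smul_left, inner_smul_right,
        hU.inverse_symm hα x y])
    (fun x => by rw [e]; linarith [hU.norm_sq_le hα x]) (C := ‖U‖ / α)
    (fun x => by
      rw [e]
      have h1 := hU.inner_inverse_le hα x x
      have h2 := mul_le_mul_of_nonneg_left h1 (norm_nonneg U)
      have h3 : ‖U‖ * (‖x‖ * ‖x‖ / α) = ‖U‖ / α * ‖x‖ ^ 2 := by ring
      nlinarith [sq_nonneg ‖x‖]) x
  rw [e] at h
  simpa using h

/-- Inversion reverses the Loewner order: Cauchy–Schwarz for `U` at `U⁻¹x` and `V⁻¹x` gives `⟨x,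
V⁻¹x⟩² ≤ ⟨x, U⁻¹x⟩⟨UV⁻¹x, V⁻¹x⟩`, where the last factor is at most `(1 + η)⟨x, V⁻¹x⟩`. -/
theorem inner_inverse_le_of_le {α : ℝ} (hα : 0 < α) {U V : H →L[ℝ] H} (hU : IsPAlpha α U)
    (hV : IsPAlpha α V) {η : ℝ} (hUV : U ≤ (1 + η) • V) (x : H) :
    inner ℝ (Ring.inverse V x) x ≤ (1 + η) * inner ℝ (Ring.inverse U x) x := by
  have hle : ∀ w, inner ℝ (U w) w ≤ (1 + η) * inner ℝ (V w) w := by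
    intro w
    have h := ((ContinuousLinearMap.le_def _ _).1 hUV).inner_nonneg_left w
    have e : inner ℝ (((1 + η) • V - U) w) w = (1 + η) * inner ℝ (V w) w - inner ℝ (U w) w := by
      simp [inner_sub_left, inner_smul_left]
    linarith
  have h1 := inner_sq_le_of_nonneg hU.symm (hU.isMetric hα).nonneg
    (Ring.inverse U x) (Ring.inverse V x)
  have h2 := hle (Ring.inverse V x)
  rw [hV.apply_inverse hα] at h2
  rw [hU.apply_inverse hα] at h1
  have h0 := (hV.inverse_isMetric hα).nonneg x
  have h0' := (hU.inverse_isMetric hα).nonneg x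
  rw [real_inner_comm] at h0 h0' ⊢
  rw [real_inner_comm x (Ring.inverse U x)]
  rcases h0.eq_or_lt with h | h
  · have hnorm := hV.norm_sq_le hα x
    rw [real_inner_comm, ← h] at hnorm
    have : x = 0 := by
      have : ‖x‖ = 0 := by nlinarith [norm_nonneg x]
      simpa using this
    simp [this]
  · have h3 := mul_le_mul_of_nonneg_left h2 h0'
    exact le_of_mul_le_mul_right (by nlinarith) h

/-- Dividing by the growth factor makes the operators decrease. Their quadratic forms then converge,
and `norm_sq_le_of_nonneg` for the positive differences turns this into strong Cauchy convergence.
-/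
theorem exists_tendsto_apply {M : ℕ → H →L[ℝ] H}
    (hs : ∀ k x y, inner ℝ (M k x) y = inner ℝ x (M k y))
    (h0 : ∀ k x, 0 ≤ inner ℝ (M k x) x) {C : ℝ} (hC : ∀ k x, inner ℝ (M k x) x ≤ C * ‖x‖ ^ 2)
    {η : ℕ → ℝ} (hη : ∀ k, 0 ≤ η k) (hηs : Summable η)
    (hM : ∀ k x, inner ℝ (M (k + 1) x) x ≤ (1 + η k) * inner ℝ (M k x) x) (w : H) :
    ∃ v, Tendsto (fun k => M k w) atTop (𝓝 v) := by
  obtain ⟨P, hP1, hPs, L, hL⟩ := exists_growth_factor hη hηs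
  have hP0 : ∀ k, 0 < P k := fun k => one_pos.trans_le (hP1 k)
  set N : ℕ → H →L[ℝ] H := fun k => (P k)⁻¹ • M k with hN
  have hNi : ∀ k x, inner ℝ (N k x) x = (P k)⁻¹ * inner ℝ (M k x) x := fun k x => by
    simp [hN, inner_smul_left]
  have hanti : ∀ x, Antitone fun k => inner ℝ (N k x) x := fun x =>
    antitone_nat_of_succ_le fun k => by
      rw [hNi, hNi, hPs, mul_inv, mul_assoc, mul_left_comm]
      refine mul_le_mul_of_nonneg_left ?_ (inv_nonneg.2 (hP0 k).le)
      rw [inv_mul_le_iff₀ (by linarith [hη k])]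
      exact hM k x
  have hNn : ∀ k x, 0 ≤ inner ℝ (N k x) x := fun k x => by
    rw [hNi]; exact mul_nonneg (inv_nonneg.2 (hP0 k).le) (h0 k x)
  have hlim := tendsto_atTop_ciInf (hanti w) ⟨0, by rintro _ ⟨k, rfl⟩; exact hNn k w⟩
  set l := ⨅ k, inner ℝ (N k w) w
  have hle : ∀ k, l ≤ inner ℝ (N k w) w := fun k => (hanti w).le_of_tendsto hlim k
  have hC' : ∀ k x, inner ℝ (N k x) x ≤ C * ‖x‖ ^ 2 := fun k x => by
    refine (le_trans ?_ (hC k x))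
    rw [hNi]
    exact mul_le_of_le_one_left (h0 k x) (inv_le_one_of_one_le₀ (hP1 k))
  have hcau : CauchySeq fun k => N k w := by
    refine cauchySeq_of_le_tendsto_0' (fun n => √(|C| * (inner ℝ (N n w) w - l))) ?_ ?_
    · intro n m hnm
      rw [dist_eq_norm]
      apply Real.le_sqrt_of_sq_le
      have e : ∀ x, inner ℝ ((N n - N m) x) x = inner ℝ (N n x) x - inner ℝ (N m x) x :=
        fun x => by simp [inner_sub_left]
      have h := norm_sq_le_of_nonneg (A := N n - N m) (C := |C|)
        (fun x y => by
          simp [hN, inner_sub_left, inner_sub_right, inner_smul_left, inner_smul_right, hs])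
        (fun x => by rw [e]; linarith [hanti x hnm])
        (fun x => by
          rw [e]
          have := mul_le_mul_of_nonneg_right (le_abs_self C) (sq_nonneg ‖x‖)
          linarith [hNn m x, hC' n x]) w
      rw [e] at h
      refine h.trans (mul_le_mul_of_nonneg_left ?_ (abs_nonneg _))
      linarith [hle m]
    · have : Tendsto (fun n => √(|C| * (inner ℝ (N n w) w - l))) atTop (𝓝 √(|C| * (l - l))) :=
        (Real.continuous_sqrt.tendsto _).comp ((hlim.sub_const l).const_mul |C|)
      simpa using this
  obtain ⟨v, hv⟩ := cauchySeq_tendsto_of_complete hcau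
  refine ⟨L • v, (hL.smul hv).congr fun k => ?_⟩
  simp [hN, smul_smul, (hP0 k).ne']

end Operators

end VMFB

namespace VMFB

/-! ### Subgradients and existence of proximal points. -/

section Convex

variable {H : Type*} [NormedAddCommGroup H] [InnerProductSpace ℝ H]

/-- `u ∈ ∂g(p)`, in terms of the finite values of `g`. -/
structure IsSubgradient (g : H → EReal) (p u : H) : Prop where
  ne_top : g p ≠ ⊤
  le : ∀ y, g y ≠ ⊤ → (g p).toReal + inner ℝ u (y - p) ≤ (g y).toReal

theorem IsSubgradient.monotone {g : H → EReal} {p q u v : H} (hu : IsSubgradient g p u)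
    (hv : IsSubgradient g q v) : 0 ≤ inner ℝ (u - v) (p - q) := by
  have h1 := hu.le q hv.ne_top
  have h2 := hv.le p hu.ne_top
  rw [← neg_sub p q, inner_neg_right] at h1
  rw [inner_sub_left]
  linarith

/-- Divide by `t` and let `t → 0`. This is how minimality along a segment becomes a first-order
condition. -/
theorem nonneg_of_forall_mul_add {A B : ℝ} (h : ∀ t : ℝ, 0 < t → t ≤ 1 → 0 ≤ t * A + t ^ 2 * B) :
    0 ≤ A := by
  by_contra hA
  push Not at hA
  have hB : 0 < |B| + |A| + 1 := by positivity
  set t := |A| / (|B| + |A| + 1) / 2 with ht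
  have hA' : 0 < |A| := abs_pos.2 hA.ne
  have htpos : 0 < t := by positivity
  have htt : t * (|B| + |A| + 1) = |A| / 2 := by rw [ht]; field_simp
  have ht1 : t ≤ 1 := by nlinarith [abs_nonneg B]
  have h1 := h t htpos ht1
  have h2 : 0 ≤ A + t * B := by
    have : 0 ≤ t * (A + t * B) := by nlinarith
    exact nonneg_of_mul_nonneg_right this htpos
  rw [abs_of_neg hA] at htt hA'
  nlinarith [le_abs_self B, abs_nonneg B]

variable {g : H → EReal}

theorem IsGammaZero.coe_toReal (hg : IsGammaZero g) {x : H} (hx : g x ≠ ⊤) :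
    ((g x).toReal : EReal) = g x := EReal.coe_toReal hx (hg.ne_bot x)

theorem IsGammaZero.combo_le (hg : IsGammaZero g) {x y : H} (hx : g x ≠ ⊤) (hy : g y ≠ ⊤)
    {s t : ℝ} (hs : 0 ≤ s) (ht : 0 ≤ t) (hst : s + t = 1) :
    g (s • x + t • y) ≠ ⊤ ∧
      (g (s • x + t • y)).toReal ≤ s * (g x).toReal + t * (g y).toReal := by
  have h := hg.convex x y s t hs ht hst
  rw [← hg.coe_toReal hx, ← hg.coe_toReal hy, ← EReal.coe_mul, ← EReal.coe_mul,
    ← EReal.coe_add] at h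
  have h1 : g (s • x + t • y) ≠ ⊤ := fun h2 => by
    rw [h2] at h
    exact absurd (top_le_iff.1 h) (EReal.coe_ne_top _)
  refine ⟨h1, ?_⟩
  rw [← hg.coe_toReal h1] at h
  exact EReal.coe_le_coe_iff.1 h

theorem IsGammaZero.segment_le (hg : IsGammaZero g) {x y : H} (hx : g x ≠ ⊤) (hy : g y ≠ ⊤)
    {t : ℝ} (ht : 0 ≤ t) (ht1 : t ≤ 1) :
    g (x + t • (y - x)) ≠ ⊤ ∧
      (g (x + t • (y - x))).toReal ≤ (g x).toReal + t * ((g y).toReal - (g x).toReal) := by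
  have h := hg.combo_le hx hy (sub_nonneg.2 ht1) ht (by ring)
  have e : (1 - t) • x + t • y = x + t • (y - x) := by module
  rw [e] at h
  exact ⟨h.1, h.2.trans_eq (by ring)⟩

theorem IsGammaZero.isClosed_le (hg : IsGammaZero g) {q : H → ℝ} (hq : Continuous q) :
    IsClosed {y | g y ≤ (q y : EReal)} := by
  exact hg.lsc.isClosed_epigraph.preimage
    (continuous_id.prodMk (continuous_coe_real_ereal.comp hq))

/-- A convex lower semicontinuous function is bounded below by a function of linear growth. -/
theorem IsGammaZero.exists_lower_bound (hg : IsGammaZero g) :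
    ∃ A B : ℝ, 0 ≤ B ∧ ∀ y, g y ≠ ⊤ → A - B * ‖y‖ ≤ (g y).toReal := by
  obtain ⟨x, hx⟩ := hg.exists_ne_top
  set c := (g x).toReal with hc
  have hlt : ((c - 1 : ℝ) : EReal) < g x := by
    rw [← hg.coe_toReal hx]
    exact EReal.coe_lt_coe_iff.2 (by linarith)
  obtain ⟨ρ, hρ, hball⟩ := Metric.eventually_nhds_iff.1 (hg.lsc x _ hlt)
  have key : ∀ y, g y ≠ ⊤ → c - 1 - 2 / ρ * ‖y - x‖ ≤ (g y).toReal := by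
    intro y hy
    have hnear : ∀ w, g w ≠ ⊤ → dist w x < ρ → c - 1 < (g w).toReal := by
      intro w hw hd
      have : ((c - 1 : ℝ) : EReal) < g w := hball hd
      rw [← hg.coe_toReal hw] at this
      exact EReal.coe_lt_coe_iff.1 this
    by_cases hd : dist y x < ρ
    · have := hnear y hy hd
      have : 0 ≤ 2 / ρ * ‖y - x‖ := by positivity
      linarith
    · push Not at hd
      rw [dist_eq_norm] at hd
      have hpos : 0 < ‖y - x‖ := hρ.trans_le hd
      -- Pull `y` back along the segment to distance `ρ/2` from `x`, where semicontinuity bounds `g`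
      -- from below; convexity carries the bound out to `y`.
      set t := ρ / (2 * ‖y - x‖) with ht
      have ht0 : 0 < t := by positivity
      have htn : t * ‖y - x‖ = ρ / 2 := by rw [ht]; field_simp
      have ht1 : t ≤ 1 := by
        rw [ht, div_le_one (by positivity)]; linarith
      obtain ⟨h1, h2⟩ := hg.segment_le hx hy ht0.le ht1
      have h3 := hnear _ h1 (by
        rw [dist_eq_norm, add_sub_cancel_left, norm_smul, Real.norm_of_nonneg ht0.le, htn]
        linarith)
      have h4 : -1 < t * ((g y).toReal - c) := by linarith
      have h5 : t * (2 / ρ * ‖y - x‖) = 1 := by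
        rw [mul_left_comm, htn]; field_simp
      have : 0 < t * ((g y).toReal - c + 2 / ρ * ‖y - x‖) := by rw [mul_add, h5]; linarith
      have := (pos_iff_pos_of_mul_pos this).1 ht0
      linarith
  refine ⟨c - 1 - 2 / ρ * ‖x‖, 2 / ρ, by positivity, fun y hy => (key y hy).trans' ?_⟩
  have : 2 / ρ * ‖y - x‖ ≤ 2 / ρ * (‖y‖ + ‖x‖) := by gcongr; exact norm_sub_le _ _
  linarith

/-- The real-valued form of the prox objective attains its minimum. -/
theorem IsGammaZero.exists_prox [CompleteSpace H] (hg : IsGammaZero g) {M : H →L[ℝ] H}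
    (hM : IsMetric M) {γ : ℝ} (hγ : 0 < γ) (x : H) :
    ∃ p, g p ≠ ⊤ ∧ ∀ y, g y ≠ ⊤ →
      1 / 2 * inner ℝ (M (x - p)) (x - p) + γ * (g p).toReal ≤
        1 / 2 * inner ℝ (M (x - y)) (x - y) + γ * (g y).toReal := by
  obtain ⟨c, hc, hcM⟩ := hM.coercive
  obtain ⟨A, B, hB, hAB⟩ := hg.exists_lower_bound
  set F : H → ℝ := fun y => 1 / 2 * inner ℝ (M (x - y)) (x - y) + γ * (g y).toReal with hF
  set S : Set ℝ := F '' {y | g y ≠ ⊤} with hS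
  have hbdd : BddBelow S := by
    -- The minimum over `s = ‖x - y‖` of `c s²/2 - γ B s`, found by completing the square.
    refine ⟨γ * (A - B * ‖x‖) - (γ * B) ^ 2 / (2 * c), ?_⟩
    rintro _ ⟨y, hy, rfl⟩
    have h1 := hAB y hy
    have h2 := hcM (x - y)
    have h3 : ‖y‖ ≤ ‖x‖ + ‖x - y‖ := by
      have := norm_sub_le x (x - y)
      simpa using this
    have h4 : γ * (A - B * (‖x‖ + ‖x - y‖)) ≤ γ * (g y).toReal := by
      refine mul_le_mul_of_nonneg_left ?_ hγ.le
      nlinarith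
    have h5 : 0 ≤ c / 2 * (‖x - y‖ - γ * B / c) ^ 2 := by positivity
    have h6 : c / 2 * (‖x - y‖ - γ * B / c) ^ 2
        = c / 2 * ‖x - y‖ ^ 2 - γ * B * ‖x - y‖ + (γ * B) ^ 2 / (2 * c) := by
      field_simp; ring
    simp only [hF]
    nlinarith
  have hne : S.Nonempty := by
    obtain ⟨y, hy⟩ := hg.exists_ne_top
    exact ⟨_, y, hy, rfl⟩
  set m := sInf S
  have hm : ∀ y, g y ≠ ⊤ → m ≤ F y := fun y hy => csInf_le hbdd ⟨y, hy, rfl⟩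
  have hFcont : Continuous fun y => 1 / 2 * inner ℝ (M (x - y)) (x - y) := by fun_prop
  -- Near-minimizers form nested closed sets whose diameters tend to zero by strong convexity;
  -- Cantor's intersection theorem provides the minimizer.
  set s : ℕ → Set H := fun n =>
    {y | g y ≤ ((γ⁻¹ * (m + 1 / (n + 1) - 1 / 2 * inner ℝ (M (x - y)) (x - y)) : ℝ) : EReal)}
    with hs
  have hmem : ∀ n y, y ∈ s n ↔ g y ≠ ⊤ ∧ F y ≤ m + 1 / (n + 1) := by
    intro n y
    constructor
    · intro h
      have h1 : g y ≠ ⊤ := fun h2 => by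
        simp only [hs, Set.mem_ofPred_eq, h2] at h
        exact absurd (top_le_iff.1 h) (EReal.coe_ne_top _)
      refine ⟨h1, ?_⟩
      simp only [hs, Set.mem_ofPred_eq] at h
      rw [← hg.coe_toReal h1, EReal.coe_le_coe_iff, le_inv_mul_iff₀ hγ] at h
      simp only [hF]
      linarith
    · rintro ⟨h1, h2⟩
      simp only [hs, Set.mem_ofPred_eq]
      rw [← hg.coe_toReal h1, EReal.coe_le_coe_iff, le_inv_mul_iff₀ hγ]
      simp only [hF] at h2
      linarith
  have hclosed : ∀ n, IsClosed (s n) := fun n =>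
    hg.isClosed_le (continuous_const.mul (continuous_const.sub hFcont))
  have hanti : ∀ n k, n ≤ k → s k ⊆ s n := by
    intro n k hnk y hy
    rw [hmem] at hy ⊢
    refine ⟨hy.1, hy.2.trans ?_⟩
    gcongr
  have hdist : ∀ n, ∀ y ∈ s n, ∀ z ∈ s n, dist y z ≤ √(8 / c * (1 / (n + 1))) := by
    intro n y hy z hz
    rw [hmem] at hy hz
    rw [dist_eq_norm]
    apply Real.le_sqrt_of_sq_le
    obtain ⟨h1, h2⟩ := hg.combo_le hy.1 hz.1 (s := 1 / 2) (t := 1 / 2) (by norm_num)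
      (by norm_num) (by norm_num)
    have h3 := hm _ h1
    -- Parallelogram law in the metric `M`, with the objective tested at the midpoint of `y` and
    -- `z`.
    have e1 := hM.inner_add_self (x - y) (x - z)
    have e2 := hM.inner_add_self (x - y) (-(x - z))
    have e3 : (x - y) + -(x - z) = -(y - z) := by abel
    have e4 : x - ((1 / 2 : ℝ) • y + (1 / 2 : ℝ) • z) = (1 / 2 : ℝ) • ((x - y) + (x - z)) := by
      module
    rw [e3] at e2
    simp only [map_neg, inner_neg_right, inner_neg_left, neg_neg] at e2
    simp only [hF] at h3 hy hz
    rw [e4, map_smul, inner_smul_left, inner_smul_right, RCLike.conj_to_real] at h3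
    have h5 := hcM (y - z)
    have h6 := mul_le_mul_of_nonneg_left h2 hγ.le
    have h7 : c * ‖y - z‖ ^ 2 ≤ 8 * (1 / (n + 1 : ℝ)) := by
      nlinarith [hy.2, hz.2]
    rw [div_mul_eq_mul_div, le_div_iff₀ hc]
    linarith
  have hbnd : ∀ n, Bornology.IsBounded (s n) := fun n =>
    Metric.isBounded_iff.2 ⟨_, fun y hy z hz => hdist n y hy z hz⟩
  have hdiam : Tendsto (fun n => Metric.diam (s n)) atTop (𝓝 0) := by
    have : Tendsto (fun n : ℕ => √(8 / c * (1 / ((n : ℝ) + 1)))) atTop (𝓝 √(8 / c * 0)) :=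
      (Real.continuous_sqrt.tendsto _).comp (tendsto_one_div_add_atTop_nhds_zero_nat.const_mul _)
    rw [mul_zero, Real.sqrt_zero] at this
    exact squeeze_zero (fun n => Metric.diam_nonneg)
      (fun n => Metric.diam_le_of_forall_dist_le (Real.sqrt_nonneg _) (hdist n)) this
  obtain ⟨p, hp⟩ := Metric.nonempty_iInter_of_nonempty_biInter hclosed hbnd (fun N => by
    obtain ⟨_, ⟨y, hy, rfl⟩, hlt⟩ := exists_lt_of_csInf_lt hne
      (show m < m + 1 / ((N : ℝ) + 1) by linarith [Nat.one_div_pos_of_nat (α := ℝ) (n := N)])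
    refine ⟨y, Set.mem_iInter₂.2 fun n hn => hanti n N hn ((hmem N y).2 ⟨hy, hlt.le⟩)⟩) hdiam
  rw [Set.mem_iInter] at hp
  have hp' := fun n => (hmem n p).1 (hp n)
  refine ⟨p, (hp' 0).1, fun y hy => le_trans ?_ (hm y hy)⟩
  have h1 : Tendsto (fun n : ℕ => m + 1 / ((n : ℝ) + 1)) atTop (𝓝 (m + 0)) :=
    tendsto_one_div_add_atTop_nhds_zero_nat.const_add m
  rw [add_zero] at h1
  exact ge_of_tendsto' h1 fun n => (hp' n).2

theorem ne_top_of_mem_solutionSet {f : H → ℝ} (hg : IsGammaZero g) {z : H}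
    (hz : z ∈ solutionSet f g) : g z ≠ ⊤ := fun h => by
  obtain ⟨y, hy⟩ := hg.exists_ne_top
  have := hz y
  rw [h, EReal.coe_add_top, ← hg.coe_toReal hy, ← EReal.coe_add] at this
  exact absurd (top_le_iff.1 this) (EReal.coe_ne_top _)

theorem IsGammaZero.coe_add_coe_mul (hg : IsGammaZero g) {y : H} (hy : g y ≠ ⊤) (γ c : ℝ) :
    (c : EReal) + (γ : EReal) * g y = ((c + γ * (g y).toReal : ℝ) : EReal) := by
  rw [← hg.coe_toReal hy, ← EReal.coe_mul, ← EReal.coe_add, EReal.toReal_coe]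

/-- The optimality condition characterizing the proximity operator. -/
theorem IsGammaZero.isSubgradient_prox [CompleteSpace H] (hg : IsGammaZero g) {M : H →L[ℝ] H}
    (hM : IsMetric M) {γ : ℝ} (hγ : 0 < γ) (x : H) :
    IsSubgradient g (prox M (fun y => (γ : EReal) * g y) x)
      (γ⁻¹ • M (x - prox M (fun y => (γ : EReal) * g y) x)) := by
  obtain ⟨p₀, hp₀, hmin₀⟩ := hg.exists_prox hM hγ x
  have hspec := @Classical.epsilon_spec H (fun p => ∀ y : H,
    ((1 / 2 * metricNorm M (x - p) ^ 2 : ℝ) : EReal) + (γ : EReal) * g p ≤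
      ((1 / 2 * metricNorm M (x - y) ^ 2 : ℝ) : EReal) + (γ : EReal) * g y) ⟨p₀, fun y => by
    by_cases hy : g y = ⊤
    · rw [hy, EReal.coe_mul_top_of_pos hγ, EReal.coe_add_top]
      exact le_top
    · rw [hg.coe_add_coe_mul hp₀, hg.coe_add_coe_mul hy, EReal.coe_le_coe_iff,
        hM.metricNorm_sq, hM.metricNorm_sq]
      exact hmin₀ y hy⟩
  change ∀ y : H, ((1 / 2 * metricNorm M (x - prox M (fun y => (γ : EReal) * g y) x) ^ 2 : ℝ)
      : EReal) + (γ : EReal) * g (prox M (fun y => (γ : EReal) * g y) x) ≤ _ at hspec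
  set p := prox M (fun y => (γ : EReal) * g y) x
  have hp : g p ≠ ⊤ := fun h => by
    have := hspec p₀
    rw [h, EReal.coe_mul_top_of_pos hγ, EReal.coe_add_top, hg.coe_add_coe_mul hp₀] at this
    exact absurd (top_le_iff.1 this) (EReal.coe_ne_top _)
  have hmin : ∀ y, g y ≠ ⊤ → 1 / 2 * inner ℝ (M (x - p)) (x - p) + γ * (g p).toReal ≤
      1 / 2 * inner ℝ (M (x - y)) (x - y) + γ * (g y).toReal := fun y hy => by
    have := hspec y
    rwa [hg.coe_add_coe_mul hp, hg.coe_add_coe_mul hy, EReal.coe_le_coe_iff,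
      hM.metricNorm_sq, hM.metricNorm_sq] at this
  refine ⟨hp, fun y hy => ?_⟩
  have h := nonneg_of_forall_mul_add
    (A := γ * ((g y).toReal - (g p).toReal) - inner ℝ (M (x - p)) (y - p))
    (B := 1 / 2 * inner ℝ (M (y - p)) (y - p)) (fun t ht ht1 => by
      obtain ⟨h1, h2⟩ := hg.segment_le hp hy ht.le ht1
      have h3 := hmin _ h1
      have e : x - (p + t • (y - p)) = (x - p) + (-t) • (y - p) := by module
      rw [e, hM.inner_add_self, map_smul, inner_smul_right, inner_smul_left, inner_smul_right,
        RCLike.conj_to_real] at h3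
      have h4 := mul_le_mul_of_nonneg_left h2 hγ.le
      nlinarith)
  rw [inner_smul_left, RCLike.conj_to_real]
  have h5 : γ * (γ⁻¹ * inner ℝ (M (x - p)) (y - p)) = inner ℝ (M (x - p)) (y - p) := by
    field_simp
  have : 0 ≤ γ * ((g y).toReal - (g p).toReal - γ⁻¹ * inner ℝ (M (x - p)) (y - p)) := by
    rw [mul_sub, h5]; exact h
  have := nonneg_of_mul_nonneg_right this hγ
  linarith

end Convex

end VMFB

namespace VMFB

/-! ### Descent lemma, cocoercivity and Fermat's rule. -/

section Smooth

variable {H : Type*} [NormedAddCommGroup H] [InnerProductSpace ℝ H] [CompleteSpace H]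
  {f : H → ℝ} {β : ℝ}

theorem hasDerivAt_comp_line (hf : Differentiable ℝ f) (x h : H) (t : ℝ) :
    HasDerivAt (fun t : ℝ => f (x + t • h)) (inner ℝ (gradient f (x + t • h)) h) t := by
  have h1 := (hf (x + t • h)).hasGradientAt.hasFDerivAt
  have h2 : HasDerivAt (fun t : ℝ => x + t • h) h t := by
    simpa using ((hasDerivAt_id t).smul_const h).const_add x
  exact (h1.comp_hasDerivAt t h2).congr_deriv (by simp)

/-- Both signs come from one monotonicity argument on `[0, 1]`: the quadratic plus `σ` times the
linearization error along the line has nonnegative derivative for `σ = ±1`. -/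
theorem abs_sub_sub_inner_le (hf : Differentiable ℝ f) (hβ : 0 < β)
    (hlip : ∀ x y : H, ‖gradient f x - gradient f y‖ ≤ 1 / β * ‖x - y‖) (x h : H) :
    |f (x + h) - f x - inner ℝ (gradient f x) h| ≤ 1 / (2 * β) * ‖h‖ ^ 2 := by
  have hbound : ∀ t : ℝ, 0 ≤ t →
      |inner ℝ (gradient f (x + t • h)) h - inner ℝ (gradient f x) h| ≤ t / β * ‖h‖ ^ 2 := by
    intro t ht
    rw [← inner_sub_left]
    refine (abs_real_inner_le_norm _ _).trans ?_
    have h1 := hlip (x + t • h) x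
    rw [add_sub_cancel_left, norm_smul, Real.norm_of_nonneg ht] at h1
    calc _ ≤ 1 / β * (t * ‖h‖) * ‖h‖ := by gcongr
      _ = _ := by ring
  have hd : ∀ σ : ℝ, ∀ t : ℝ, HasDerivAt (fun t : ℝ => 1 / (2 * β) * ‖h‖ ^ 2 * t ^ 2
      + σ * (f (x + t • h) - t * inner ℝ (gradient f x) h))
      (t / β * ‖h‖ ^ 2 + σ * (inner ℝ (gradient f (x + t • h)) h - inner ℝ (gradient f x) h)) t := by
    intro σ t
    have h1 := ((hasDerivAt_comp_line hf x h t).sub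
      ((hasDerivAt_id t).mul_const (inner ℝ (gradient f x) h))).const_mul σ
    have h2 := ((hasDerivAt_id t).pow 2).const_mul (1 / (2 * β) * ‖h‖ ^ 2)
    refine (h2.add h1).congr_deriv ?_
    simp only [id_eq]
    field_simp
    ring
  have hmono : ∀ σ : ℝ, |σ| ≤ 1 → MonotoneOn (fun t : ℝ => 1 / (2 * β) * ‖h‖ ^ 2 * t ^ 2
      + σ * (f (x + t • h) - t * inner ℝ (gradient f x) h)) (Set.Icc 0 1) := by
    intro σ hσ
    refine monotoneOn_of_deriv_nonneg (convex_Icc 0 1)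
      (fun t _ => (hd σ t).continuousAt.continuousWithinAt)
      (fun t _ => (hd σ t).differentiableAt.differentiableWithinAt) fun t ht => ?_
    rw [interior_Icc] at ht
    rw [(hd σ t).deriv]
    have h1 := hbound t ht.1.le
    have h2 : |σ * (inner ℝ (gradient f (x + t • h)) h - inner ℝ (gradient f x) h)|
        ≤ t / β * ‖h‖ ^ 2 := by
      rw [abs_mul]
      exact (mul_le_of_le_one_left (abs_nonneg _) hσ).trans h1
    linarith [neg_abs_le (σ * (inner ℝ (gradient f (x + t • h)) h - inner ℝ (gradient f x) h))]
  have h1 := hmono 1 (by norm_num) (Set.left_mem_Icc.2 zero_le_one)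
    (Set.right_mem_Icc.2 zero_le_one) zero_le_one
  have h2 := hmono (-1) (by norm_num) (Set.left_mem_Icc.2 zero_le_one)
    (Set.right_mem_Icc.2 zero_le_one) zero_le_one
  simp only [zero_smul, one_smul, add_zero] at h1 h2
  rw [abs_le]
  constructor <;> nlinarith

theorem add_inner_gradient_le (hf : Differentiable ℝ f) (hβ : 0 < β)
    (hconv : ConvexOn ℝ Set.univ f)
    (hlip : ∀ x y : H, ‖gradient f x - gradient f y‖ ≤ 1 / β * ‖x - y‖) (x y : H) :
    f x + inner ℝ (gradient f x) (y - x) ≤ f y := by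
  have h := nonneg_of_forall_mul_add (A := f y - f x - inner ℝ (gradient f x) (y - x))
    (B := 1 / (2 * β) * ‖y - x‖ ^ 2) (fun t ht ht1 => by
      have h1 := (abs_le.1 (abs_sub_sub_inner_le hf hβ hlip x (t • (y - x)))).1
      rw [inner_smul_right, norm_smul, Real.norm_of_nonneg ht.le] at h1
      have h2 := hconv.2 (Set.mem_univ x) (Set.mem_univ y) (sub_nonneg.2 ht1) ht.le (by ring)
      have e : (1 - t) • x + t • y = x + t • (y - x) := by module
      rw [e, smul_eq_mul, smul_eq_mul] at h2
      nlinarith)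
  linarith

/-- Evaluate `f` at `y - β(∇f y - ∇f x)`: the tangent at `x` bounds it from below and the descent
lemma at `y` from above. The step `β` optimizes the resulting quadratic. -/
theorem add_inner_gradient_add_sq_le (hf : Differentiable ℝ f) (hβ : 0 < β)
    (hconv : ConvexOn ℝ Set.univ f)
    (hlip : ∀ x y : H, ‖gradient f x - gradient f y‖ ≤ 1 / β * ‖x - y‖) (x y : H) :
    f x + inner ℝ (gradient f x) (y - x) + β / 2 * ‖gradient f y - gradient f x‖ ^ 2 ≤ f y := by
  set e := gradient f y - gradient f x with he
  have h1 := add_inner_gradient_le hf hβ hconv hlip x (y + (-β) • e)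
  have h2 := (abs_le.1 (abs_sub_sub_inner_le hf hβ hlip y ((-β) • e))).2
  rw [inner_smul_right, norm_smul, Real.norm_eq_abs, abs_neg, abs_of_pos hβ, mul_pow] at h2
  have e1 : y + (-β) • e - x = (y - x) + (-β) • e := by abel
  rw [e1, inner_add_right, inner_smul_right] at h1
  have e2 : inner ℝ (gradient f y) e = inner ℝ (gradient f x) e + ‖e‖ ^ 2 := by
    rw [← real_inner_self_eq_norm_sq, ← inner_add_left, he]
    congr 1
    abel
  have e3 : 1 / (2 * β) * (β ^ 2 * ‖e‖ ^ 2) = β / 2 * ‖e‖ ^ 2 := by field_simp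
  rw [e3, e2] at h2
  nlinarith

/-- Baillon–Haddad: the gradient is cocoercive. -/
theorem cocoercive_gradient (hf : Differentiable ℝ f) (hβ : 0 < β)
    (hconv : ConvexOn ℝ Set.univ f)
    (hlip : ∀ x y : H, ‖gradient f x - gradient f y‖ ≤ 1 / β * ‖x - y‖) (x y : H) :
    β * ‖gradient f x - gradient f y‖ ^ 2 ≤ inner ℝ (gradient f x - gradient f y) (x - y) := by
  have h1 := add_inner_gradient_add_sq_le hf hβ hconv hlip x y
  have h2 := add_inner_gradient_add_sq_le hf hβ hconv hlip y x
  rw [norm_sub_rev, ← neg_sub x y, inner_neg_right] at h1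
  rw [inner_sub_left]
  linarith

/-- Along a segment from `z`, convexity bounds the change of `g` linearly, and that of `f` is linear
up to `O(t²)`. -/
theorem isSubgradient_of_mem_solutionSet {g : H → EReal} (hg : IsGammaZero g)
    (hf : Differentiable ℝ f) (hβ : 0 < β)
    (hlip : ∀ x y : H, ‖gradient f x - gradient f y‖ ≤ 1 / β * ‖x - y‖) {z : H}
    (hz : z ∈ solutionSet f g) : IsSubgradient g z (-gradient f z) := by
  have hzt := ne_top_of_mem_solutionSet hg hz
  have hmin : ∀ y, g y ≠ ⊤ → f z + (g z).toReal ≤ f y + (g y).toReal := fun y hy => by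
    have := hz y
    rwa [← hg.coe_toReal hy, ← hg.coe_toReal hzt, ← EReal.coe_add, ← EReal.coe_add,
      EReal.coe_le_coe_iff] at this
  refine ⟨hzt, fun y hy => ?_⟩
  have h := nonneg_of_forall_mul_add
    (A := inner ℝ (gradient f z) (y - z) + ((g y).toReal - (g z).toReal))
    (B := 1 / (2 * β) * ‖y - z‖ ^ 2) (fun t ht ht1 => by
      obtain ⟨h1, h2⟩ := hg.segment_le hzt hy ht.le ht1
      have h3 := hmin _ h1
      have h4 := (abs_le.1 (abs_sub_sub_inner_le hf hβ hlip z (t • (y - z)))).2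
      rw [inner_smul_right, norm_smul, Real.norm_of_nonneg ht.le] at h4
      nlinarith)
  rw [inner_neg_left]
  linarith

end Smooth

/-! ### Algebra of one forward-backward step. -/

section Step

variable {H : Type*} [NormedAddCommGroup H] [InnerProductSpace ℝ H]

/-- The excess of the forward-backward residual over the averagedness inequality, as a sum of
nonnegative terms: monotonicity, cocoercivity, a square, and the deviation of the metric. -/
theorem excess_eq (M : H →L[ℝ] H) {γ β ω : ℝ} (hγ : γ ≠ 0) (hβ : β ≠ 0) (r d b : H) :
    inner ℝ (M r) d - (1 - γ * ω / (4 * β)) * inner ℝ (M r) r =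
      γ * inner ℝ (γ⁻¹ • M r - b) (d - r) + γ * (inner ℝ b d - β * ‖b‖ ^ 2)
        + γ * β * ‖b - (2 * β)⁻¹ • r‖ ^ 2
        + γ / (4 * β) * (ω * inner ℝ (M r) r - ‖r‖ ^ 2) := by
  rw [norm_sub_sq_real, norm_smul, inner_smul_right, mul_pow, Real.norm_eq_abs, sq_abs,
    inner_sub_left, inner_smul_left, inner_sub_right, inner_sub_right, RCLike.conj_to_real]
  field_simp
  ring

/-- In the regime `γ ω ≤ 2 β - ε` the averagedness inequality is strict away from fixed points:
the residual is controlled by the excess, uniformly over bounded sets. -/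
theorem residual_sq_le {M : H →L[ℝ] H} {γ γ₀ β ω α ε D X : ℝ} (hγ₀ : 0 < γ₀) (hγ : γ₀ ≤ γ)
    (hβ : 0 < β) (hα : 0 < α) (hω : 0 ≤ ω) (hε : 0 < ε) (hγω : γ * ω ≤ 2 * β - ε) {r d b : H}
    (hmon : 0 ≤ inner ℝ (γ⁻¹ • M r - b) (d - r)) (hcoc : β * ‖b‖ ^ 2 ≤ inner ℝ b d)
    (hMr : ‖r‖ ^ 2 ≤ ω * inner ℝ (M r) r)
    (hdev : ‖ω • M r - r‖ ^ 2 ≤ ω / α * (ω * inner ℝ (M r) r - ‖r‖ ^ 2))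
    (hr : ‖r‖ ≤ D) (hd : ‖d‖ ≤ D)
    (hX : X = inner ℝ (M r) d - (1 - γ * ω / (4 * β)) * inner ℝ (M r) r) :
    0 ≤ X ∧ ε / (4 * β) * ‖r‖ ^ 2 ≤ (4 * β * D / √(γ₀ * β) + D * √(8 * β ^ 2 / (α * γ₀ ^ 2))) * √X
      + 4 * β / γ₀ * X := by
  have hγp : 0 < γ := hγ₀.trans_le hγ
  have hex := excess_eq M (ω := ω) hγp.ne' hβ.ne' r d b
  rw [← hX] at hex
  set ξ := b - (2 * β)⁻¹ • r with hξ
  set m := inner ℝ (M r) r with hm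
  have t1 : 0 ≤ γ * inner ℝ (γ⁻¹ • M r - b) (d - r) := mul_nonneg hγp.le hmon
  have t2 : 0 ≤ γ * (inner ℝ b d - β * ‖b‖ ^ 2) := mul_nonneg hγp.le (by linarith)
  have t3 : 0 ≤ γ * β * ‖ξ‖ ^ 2 := by positivity
  have t4 : 0 ≤ γ / (4 * β) * (ω * m - ‖r‖ ^ 2) := mul_nonneg (by positivity) (by linarith)
  have hX0 : 0 ≤ X := by linarith
  have hD : 0 ≤ D := (norm_nonneg r).trans hr
  refine ⟨hX0, ?_⟩
  -- Each nonnegative term of the excess is at most `X`; the lower bound `γ₀ ≤ γ` makes the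
  -- resulting estimates uniform.
  have b2 : inner ℝ b d - β * ‖b‖ ^ 2 ≤ X / γ₀ := by
    rw [le_div_iff₀ hγ₀]
    have := mul_le_mul_of_nonneg_left hγ (sub_nonneg.2 hcoc)
    nlinarith
  have b3 : γ₀ * β * ‖ξ‖ ^ 2 ≤ X := by
    have : γ₀ * β * ‖ξ‖ ^ 2 ≤ γ * β * ‖ξ‖ ^ 2 := by gcongr
    linarith
  have b3' : ‖ξ‖ ≤ √X / √(γ₀ * β) := by
    rw [← Real.sqrt_div hX0]
    apply Real.le_sqrt_of_sq_le
    rw [le_div_iff₀ (by positivity)]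
    linarith
  have hωle : ω ≤ 2 * β / γ₀ := by
    rw [le_div_iff₀ hγ₀]
    nlinarith
  have b4 : ω * m - ‖r‖ ^ 2 ≤ 4 * β * X / γ₀ := by
    rw [le_div_iff₀ hγ₀]
    have h1 : γ * (ω * m - ‖r‖ ^ 2) ≤ 4 * β * X := by
      have : 4 * β * (γ / (4 * β) * (ω * m - ‖r‖ ^ 2)) ≤ 4 * β * X := by
        apply mul_le_mul_of_nonneg_left _ (by positivity)
        linarith
      have e : 4 * β * (γ / (4 * β) * (ω * m - ‖r‖ ^ 2)) = γ * (ω * m - ‖r‖ ^ 2) := by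
        field_simp
      linarith
    have := mul_le_mul_of_nonneg_left hγ (sub_nonneg.2 hMr)
    nlinarith
  have b4' : ‖ω • M r - r‖ ≤ √(8 * β ^ 2 / (α * γ₀ ^ 2)) * √X := by
    rw [← Real.sqrt_mul (by positivity)]
    apply Real.le_sqrt_of_sq_le
    calc _ ≤ ω / α * (ω * m - ‖r‖ ^ 2) := hdev
      _ ≤ (2 * β / γ₀) / α * (4 * β * X / γ₀) := by
        apply mul_le_mul _ b4 (sub_nonneg.2 hMr) (by positivity)
        gcongr
      _ = _ := by field_simp; ring
  have e1 : inner ℝ r d = 2 * β * inner ℝ b d - 2 * β * inner ℝ ξ d := by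
    rw [hξ, inner_sub_left, inner_smul_left, RCLike.conj_to_real]
    field_simp
    ring
  have e2 : 4 * β ^ 2 * ‖b‖ ^ 2 = ‖r‖ ^ 2 + 4 * β * inner ℝ ξ r + 4 * β ^ 2 * ‖ξ‖ ^ 2 := by
    have : b = ξ + (2 * β)⁻¹ • r := by rw [hξ]; abel
    rw [this, norm_add_sq_real, norm_smul, inner_smul_right, mul_pow, Real.norm_eq_abs, sq_abs]
    field_simp
    ring
  have e3 : ω * inner ℝ (M r) d = inner ℝ r d + inner ℝ (ω • M r - r) d := by
    rw [inner_sub_left, inner_smul_left, RCLike.conj_to_real]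
    ring
  have c1 : inner ℝ ξ r ≤ √X / √(γ₀ * β) * D :=
    (real_inner_le_norm _ _).trans (by gcongr)
  have c2 : -(inner ℝ ξ d) ≤ √X / √(γ₀ * β) * D := by
    refine (neg_le_abs _).trans ((abs_real_inner_le_norm _ _).trans (by gcongr))
  have c3 : inner ℝ (ω • M r - r) d ≤ √(8 * β ^ 2 / (α * γ₀ ^ 2)) * √X * D :=
    (real_inner_le_norm _ _).trans (by gcongr)
  have hδ : ε / (4 * β) ≤ 1 / 2 - γ * ω / (4 * β) := by
    rw [le_sub_iff_add_le, ← add_div, div_le_iff₀ (by positivity)]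
    linarith
  -- Up to errors controlled by `X`, one has `ωMr ≈ r ≈ 2βb` and `⟨b, d⟩ ≈ β‖b‖²`, so `ω⟨Mr, d⟩ ≈
  -- ‖r‖²/2 ≤ ωm/2`. Comparing with `ωX ≥ 0` leaves the coefficient `1/2 - γω/(4β)`, which is at
  -- least `ε/(4β)`.
  have main : (1 / 2 - γ * ω / (4 * β)) * (ω * m) ≤
      2 * β * inner ℝ ξ r + 2 * β ^ 2 * ‖ξ‖ ^ 2 + 2 * β * (inner ℝ b d - β * ‖b‖ ^ 2)
        - 2 * β * inner ℝ ξ d + inner ℝ (ω • M r - r) d := by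
    have h1 : ω * X = ω * inner ℝ (M r) d - (1 - γ * ω / (4 * β)) * (ω * m) := by
      rw [hX]; ring
    have h2 : 0 ≤ ω * X := mul_nonneg hω hX0
    have h3 : (1 / 2 - γ * ω / (4 * β)) * (ω * m) =
      (1 - γ * ω / (4 * β)) * (ω * m) - 1 / 2 * (ω * m) := by ring
    linarith
  have hl : ε / (4 * β) * ‖r‖ ^ 2 ≤ (1 / 2 - γ * ω / (4 * β)) * (ω * m) := by
    apply mul_le_mul hδ hMr (by positivity)
    exact le_trans (by positivity) hδ
  have b3'' : 2 * β ^ 2 * ‖ξ‖ ^ 2 ≤ 2 * β / γ₀ * X := by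
    have : 2 * β ^ 2 * ‖ξ‖ ^ 2 = 2 * β / γ₀ * (γ₀ * β * ‖ξ‖ ^ 2) := by field_simp
    rw [this]; gcongr
  have b2' : 2 * β * (inner ℝ b d - β * ‖b‖ ^ 2) ≤ 2 * β / γ₀ * X := by
    calc _ ≤ 2 * β * (X / γ₀) := by gcongr
      _ = _ := by ring
  have c1' : 2 * β * inner ℝ ξ r ≤ 2 * β * (√X / √(γ₀ * β) * D) := by gcongr
  have c2' : 2 * β * -(inner ℝ ξ d) ≤ 2 * β * (√X / √(γ₀ * β) * D) := by gcongr
  calc _ ≤ 2 * β * (√X / √(γ₀ * β) * D) + 2 * β / γ₀ * X + 2 * β / γ₀ * X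
        + 2 * β * (√X / √(γ₀ * β) * D) + √(8 * β ^ 2 / (α * γ₀ ^ 2)) * √X * D := by linarith
    _ = _ := by ring

theorem one_div_avgConst {β γ : ℝ} {U : H →L[ℝ] H} (hβ : 0 < β) : 1 / avgConst β γ U = 2 - γ * ‖U‖ / (2 * β) := by
  rw [avgConst, one_div_div]
  field_simp
  ring

end Step

end VMFB

namespace VMFB

/-! ### Quasi-Fejér sequences and the excursion argument. -/

section Sequences

/-- A nonnegative sequence with `s (k+1) ≤ (1 + η k) s k + ε k`, for summable perturbations,
converges. -/
theorem exists_tendsto_of_le_one_add_mul_add {s η ε : ℕ → ℝ} (hs : ∀ k, 0 ≤ s k)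
    (hη : ∀ k, 0 ≤ η k) (hηs : Summable η) (hε : ∀ k, 0 ≤ ε k) (hεs : Summable ε)
    (h : ∀ k, s (k + 1) ≤ (1 + η k) * (s k + ε k)) : ∃ l, Tendsto s atTop (𝓝 l) := by
  obtain ⟨P, hP1, hPs, L, hL⟩ := exists_growth_factor hη hηs
  have hP0 : ∀ k, 0 < P k := fun k => one_pos.trans_le (hP1 k)
  have hanti : Antitone fun k => s k / P k - ∑ j ∈ Finset.range k, ε j := by
    refine antitone_nat_of_succ_le fun k => ?_
    rw [Finset.sum_range_succ]
    have h1 : s (k + 1) / P (k + 1) ≤ s k / P k + ε k := by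
      rw [hPs, div_le_iff₀ (mul_pos (by linarith [hη k]) (hP0 k))]
      refine (h k).trans ?_
      have e : (s k / P k + ε k) * ((1 + η k) * P k) = (1 + η k) * (s k + ε k * P k) := by
        field_simp [(hP0 k).ne']
      rw [e]
      have := mul_le_mul_of_nonneg_left (hP1 k) (hε k)
      refine mul_le_mul_of_nonneg_left (by linarith) (by linarith [hη k])
    linarith
  have hlim := tendsto_atTop_ciInf hanti ⟨-∑' j, ε j, by
    rintro _ ⟨k, rfl⟩
    have h1 := hεs.sum_le_tsum (Finset.range k) fun j _ => hε j
    have h2 : 0 ≤ s k / P k := div_nonneg (hs k) (hP0 k).le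
    simp only
    linarith⟩
  have h3 := (hlim.add hεs.hasSum.tendsto_sum_nat).mul hL
  refine ⟨_, h3.congr fun k => ?_⟩
  field_simp [(hP0 k).ne']
  ring

/-- The decrements of a quasi-Fejér monotone sequence are summable. -/
theorem summable_of_quasiFejer {s A η ε Δ : ℕ → ℝ} (hs : ∀ k, 0 ≤ s k) (hA : ∀ k, 0 ≤ A k)
    (hη : ∀ k, 0 ≤ η k) (hηs : Summable η) (hε : ∀ k, 0 ≤ ε k) (hεs : Summable ε)
    (hΔ : ∀ k, 0 ≤ Δ k) (hAs : ∀ k, A k ^ 2 ≤ s k ^ 2 - Δ k)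
    (h : ∀ k, s (k + 1) ^ 2 ≤ (1 + η k) * (A k + ε k) ^ 2) {S : ℝ} (hS : ∀ k, s k ≤ S) :
    Summable Δ := by
  have hS0 : 0 ≤ S := (hs 0).trans (hS 0)
  set E := ∑' j, ε j
  have hE : ∀ k, ε k ≤ E := fun k => hεs.le_tsum k fun j _ => hε j
  have hE0 : 0 ≤ E := (hε 0).trans (hE 0)
  have hAS : ∀ k, A k ≤ S := fun k =>
    (abs_le_of_sq_le_sq' ((by nlinarith [hAs k, hΔ k, hs k, hS k] : A k ^ 2 ≤ S ^ 2)) hS0).2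
  have hstep : ∀ k, Δ k ≤ s k ^ 2 - s (k + 1) ^ 2 + (η k * (S + E) ^ 2 + (2 * S + E) * ε k) := by
    intro k
    have h1 : (A k + ε k) ^ 2 ≤ (S + E) ^ 2 := by
      have := hA k; have := hε k
      gcongr
      · exact hAS k
      · exact hE k
    have h2 := mul_le_mul_of_nonneg_left h1 (hη k)
    have h3 : 2 * A k * ε k + ε k * ε k ≤ (2 * S + E) * ε k := by
      have := mul_le_mul_of_nonneg_right (hAS k) (hε k)
      have := mul_le_mul_of_nonneg_right (hE k) (hε k)
      nlinarith
    nlinarith [h k, hAs k]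
  have hsum : Summable fun k => η k * (S + E) ^ 2 + (2 * S + E) * ε k :=
    (hηs.mul_right _).add (hεs.mul_left _)
  refine summable_of_sum_range_le hΔ
    (c := S ^ 2 + ∑' k, (η k * (S + E) ^ 2 + (2 * S + E) * ε k)) fun n => ?_
  have h1 : ∑ k ∈ Finset.range n, Δ k ≤ (s 0 ^ 2 - s n ^ 2)
      + ∑ k ∈ Finset.range n, (η k * (S + E) ^ 2 + (2 * S + E) * ε k) := by
    rw [← Finset.sum_range_sub' (fun k => s k ^ 2), ← Finset.sum_add_distrib]
    exact Finset.sum_le_sum fun k _ => hstep k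
  have h2 := hsum.sum_le_tsum (Finset.range n) fun k _ =>
    add_nonneg (mul_nonneg (hη k) (sq_nonneg _)) (mul_nonneg (by positivity) (hε k))
  nlinarith [hs 0, hS 0, sq_nonneg (s n)]

variable {H : Type*} [NormedAddCommGroup H]

/-- Residuals `ρ` along a sequence `x` tend to zero if the total step length spent where `ρ` is
not small is finite and `ρ k` is controlled by `ρ m` and `‖x k - x m‖`. -/
theorem tendsto_zero_of_summable_excursions {ρ lam X e : ℕ → ℝ} {x : ℕ → H} {R C C' Λ : ℝ}
    (hρ : ∀ k, 0 ≤ ρ k) (hρR : ∀ k, ρ k ≤ R) (hlam : ∀ k, 0 ≤ lam k) (hlamΛ : ∀ k, lam k ≤ Λ)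
    (hC : 0 ≤ C) (hC' : 0 ≤ C') (hX : ∀ k, 0 ≤ X k) (he : ∀ k, 0 ≤ e k) (hes : Summable e)
    (hlX : Summable fun k => lam k * X k) (hdiv : ¬ Summable lam)
    (hgap : ∀ ε > 0, ∃ c > 0, ∀ k, ε ≤ ρ k → c ≤ X k)
    (hstep : ∀ k, ‖x (k + 1) - x k‖ ≤ lam k * ρ k + e k)
    (hcmp : ∀ m k, ρ k ≤ C * ρ m + C' * ‖x k - x m‖) : Tendsto ρ atTop (𝓝 0) := by
  have hR : 0 ≤ R := (hρ 0).trans (hρR 0)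
  have hΛ : 0 ≤ Λ := (hlam 0).trans (hlamΛ 0)
  have key : ∀ ε > 0, ∃ N, ∀ k ≥ N, ρ k ≤ (C + C' * (Λ + 1)) * ε := by
    intro ε hε
    obtain ⟨c, hc, hcX⟩ := hgap ε hε
    -- Where `ρ k ≥ ε` one has `X k ≥ c`, so the step length is at most `w k`, a summable quantity.
    set w : ℕ → ℝ := fun k => c⁻¹ * R * (lam k * X k) + e k with hw
    have hw0 : ∀ k, 0 ≤ w k := fun k => by
      have := mul_nonneg (hlam k) (hX k)
      have := he k
      positivity
    have hws : Summable w := (hlX.mul_left _).add hes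
    have htail := tendsto_sum_nat_add w
    obtain ⟨N, hN⟩ := (htail.eventually (gt_mem_nhds hε)).exists
    have hsum : ∀ n, ∑ j ∈ Finset.range n, w (j + N) ≤ ε := fun n =>
      (((summable_nat_add_iff N).2 hws).sum_le_tsum _ fun j _ => hw0 _).trans hN.le
    have hbig : ∀ k, ε ≤ ρ k → lam k * ρ k + e k ≤ w k := fun k hk => by
      have h1 : 1 ≤ c⁻¹ * X k := by
        rw [le_inv_mul_iff₀ hc, mul_one]; exact hcX k hk
      have h2 : lam k * ρ k ≤ lam k * R * (c⁻¹ * X k) := by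
        calc lam k * ρ k ≤ lam k * R * 1 := by
              rw [mul_one]; exact mul_le_mul_of_nonneg_left (hρR k) (hlam k)
          _ ≤ _ := mul_le_mul_of_nonneg_left h1 (mul_nonneg (hlam k) hR)
      simp only [hw]
      nlinarith
    -- Otherwise `X ≥ c` from `N` on, and summability of `lam * X` would make `lam` summable.
    obtain ⟨m₁, hm₁, hρm₁⟩ : ∃ m ≥ N, ρ m < ε := by
      by_contra hcon
      push Not at hcon
      apply hdiv
      rw [← summable_nat_add_iff N]
      refine Summable.of_nonneg_of_le (fun k => hlam _) (fun k => ?_)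
        (((summable_nat_add_iff N).2 hlX).mul_left c⁻¹)
      have h1 := hcX (k + N) (hcon _ (by omega))
      rw [le_inv_mul_iff₀ hc, mul_comm]
      exact mul_le_mul_of_nonneg_left h1 (hlam _)
    -- `m` is the last earlier index with small residual. The step leaving it costs at most `Λ * ε`
    -- plus its error; every later one is paid for by `w`.
    have hind : ∀ i, ∃ m, ρ m < ε ∧
        ‖x (m₁ + i) - x m‖ ≤ Λ * ε + ∑ j ∈ Finset.range (m₁ - N + i), w (j + N) := by
      intro i
      induction i with
      | zero =>
        refine ⟨m₁, hρm₁, ?_⟩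
        simp only [add_zero, sub_self, norm_zero]
        exact add_nonneg (by positivity) (Finset.sum_nonneg fun j _ => hw0 _)
      | succ i ih =>
        rw [← add_assoc, ← add_assoc, Finset.sum_range_succ]
        have hidx : m₁ - N + i + N = m₁ + i := by omega
        rw [hidx]
        have hpos : 0 ≤ ∑ j ∈ Finset.range (m₁ - N + i), w (j + N) :=
          Finset.sum_nonneg fun j _ => hw0 _
        by_cases hs : ρ (m₁ + i) < ε
        · refine ⟨m₁ + i, hs, (hstep _).trans ?_⟩
          have h1 : lam (m₁ + i) * ρ (m₁ + i) ≤ Λ * ε :=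
            mul_le_mul (hlamΛ _) hs.le (hρ _) hΛ
          have h2 : e (m₁ + i) ≤ w (m₁ + i) := by
            have := mul_nonneg (hlam (m₁ + i)) (hX (m₁ + i))
            simp only [hw]
            have : 0 ≤ c⁻¹ * R * (lam (m₁ + i) * X (m₁ + i)) := by positivity
            linarith
          linarith
        · push Not at hs
          obtain ⟨m, hm, hxm⟩ := ih
          refine ⟨m, hm, (norm_sub_le_norm_sub_add_norm_sub _ (x (m₁ + i)) _).trans ?_⟩
          have := (hstep (m₁ + i)).trans (hbig _ hs)
          linarith
    refine ⟨m₁, fun k hk => ?_⟩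
    obtain ⟨i, rfl⟩ := Nat.exists_eq_add_of_le hk
    obtain ⟨m, hm, hxm⟩ := hind i
    calc ρ (m₁ + i) ≤ C * ρ m + C' * ‖x (m₁ + i) - x m‖ := hcmp m _
      _ ≤ C * ε + C' * (Λ * ε + ε) := by
        gcongr
        exact hxm.trans (by linarith [hsum (m₁ - N + i)])
      _ = _ := by ring
  rw [Metric.tendsto_atTop]
  intro ε hε
  have hK : 0 < C + C' * (Λ + 1) + 1 := by positivity
  obtain ⟨N, hN⟩ := key (ε / (C + C' * (Λ + 1) + 1)) (by positivity)
  refine ⟨N, fun k hk => ?_⟩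
  rw [Real.dist_eq, sub_zero, abs_of_nonneg (hρ k)]
  refine (hN k hk).trans_lt ?_
  rw [mul_div_assoc', div_lt_iff₀ hK]
  nlinarith

end Sequences

end VMFB

namespace VMFB

/-! ### Weak limits, Opial's lemma and closedness of the solution set. -/

section Weak

variable {H : Type*} [NormedAddCommGroup H] [InnerProductSpace ℝ H]

/-- Mazur's theorem: a functional strictly separating `z` from `S` would contradict weak
convergence. -/
theorem mem_of_tendsto_inner [CompleteSpace H] {ι : Type*} {l : Filter ι} [l.NeBot] {S : Set H}
    (hS : Convex ℝ S) (hSc : IsClosed S) {p : ι → H} (hp : ∀ᶠ k in l, p k ∈ S) {z : H}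
    (hz : ∀ w, Tendsto (fun k => inner ℝ (p k) w) l (𝓝 (inner ℝ z w))) : z ∈ S := by
  by_contra hzS
  obtain ⟨φ, c, hφz, hφS⟩ := geometric_hahn_banach_point_closed hS hSc hzS
  set v := (InnerProductSpace.toDual ℝ H).symm φ
  have hv : ∀ y, φ y = inner ℝ y v := fun y => by
    rw [real_inner_comm]; exact (InnerProductSpace.toDual_symm_apply).symm
  rw [hv] at hφz
  have := ge_of_tendsto (hz v) (hp.mono fun k hk => ((hv (p k)) ▸ (hφS _ hk)).le)
  linarith

theorem tendsto_toWeakSpace [CompleteSpace H] {ι : Type*} {l : Filter ι} {p : ι → H} {z : H}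
    (hz : ∀ w, Tendsto (fun k => inner ℝ (p k) w) l (𝓝 (inner ℝ z w))) :
    Tendsto (fun k => toWeakSpace ℝ H (p k)) l (𝓝 (toWeakSpace ℝ H z)) := by
  refine (WeakBilin.tendsto_iff_forall_eval_tendsto (topDualPairing ℝ H).flip ?_).2 fun φ => ?_
  · intro a b hab
    refine ext_inner_right ℝ fun w => ?_
    have := LinearMap.congr_fun hab (InnerProductSpace.toDual ℝ H w)
    simp only [LinearMap.flip_apply, topDualPairing_apply, InnerProductSpace.toDual_apply_apply]
      at this
    rw [real_inner_comm, this, real_inner_comm]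
  · have h := hz ((InnerProductSpace.toDual ℝ H).symm φ)
    have hv : ∀ y, inner ℝ y ((InnerProductSpace.toDual ℝ H).symm φ) = φ y := fun y => by
      rw [real_inner_comm]; exact InnerProductSpace.toDual_symm_apply
    simp only [hv] at h
    exact h

/-- Weak compactness of balls of a Hilbert space, along an ultrafilter. -/
theorem exists_tendsto_inner [CompleteSpace H] {ι : Type*} (l : Ultrafilter ι) {x : ι → H} {D : ℝ}
    (hx : ∀ k, ‖x k‖ ≤ D) :
    ∃ z, ∀ w, Tendsto (fun k => inner ℝ (x k) w) l (𝓝 (inner ℝ z w)) := by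
  have hcomp := WeakDual.isCompact_closedBall (𝕜 := ℝ) (E := H) 0 D
  have hmem : ∀ k, StrongDual.toWeakDual (InnerProductSpace.toDual ℝ H (x k)) ∈
      WeakDual.toStrongDual ⁻¹' Metric.closedBall (0 : StrongDual ℝ H) D := fun k => by
    change InnerProductSpace.toDual ℝ H (x k) ∈ Metric.closedBall (0 : StrongDual ℝ H) D
    simpa using hx k
  obtain ⟨φ, -, hφ⟩ := hcomp.ultrafilter_le_nhds
    (l.map fun k => StrongDual.toWeakDual (InnerProductSpace.toDual ℝ H (x k)))
    (le_principal_iff.2 (mem_map.2 (Eventually.of_forall hmem)))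
  refine ⟨(InnerProductSpace.toDual ℝ H).symm (WeakDual.toStrongDual φ), fun w => ?_⟩
  have h1 := (WeakDual.eval_continuous w).tendsto φ |>.comp
    (show Tendsto (fun k => StrongDual.toWeakDual (InnerProductSpace.toDual ℝ H (x k))) l (𝓝 φ)
      from hφ)
  rw [InnerProductSpace.toDual_symm_apply]
  exact h1

/-- Opial's lemma for a strongly convergent sequence of uniformly coercive metrics. -/
theorem exists_tendsto_inner_of_opial [CompleteSpace H] {M : ℕ → H →L[ℝ] H} {Z : Set H}
    {x : ℕ → H} {D c : ℝ} (hs : ∀ k x y, inner ℝ (M k x) y = inner ℝ x (M k y)) (hc : 0 < c)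
    (hcM : ∀ k w, c * ‖w‖ ^ 2 ≤ inner ℝ (M k w) w) (hx : ∀ k, ‖x k‖ ≤ D)
    (hlim : ∀ w, ∃ v, Tendsto (fun k => M k w) atTop (𝓝 v))
    (hfejer : ∀ z ∈ Z, ∃ l, Tendsto (fun k => inner ℝ (M k (x k - z)) (x k - z)) atTop (𝓝 l))
    (hcluster : ∀ l : Ultrafilter ℕ, (l : Filter ℕ) ≤ atTop → ∀ z,
      (∀ w, Tendsto (fun k => inner ℝ (x k) w) l (𝓝 (inner ℝ z w))) → z ∈ Z) :
    ∃ z ∈ Z, ∀ w, Tendsto (fun k => inner ℝ (x k) w) atTop (𝓝 (inner ℝ z w)) := by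
  have huniq : ∀ l₁ l₂ : Ultrafilter ℕ, (l₁ : Filter ℕ) ≤ atTop → (l₂ : Filter ℕ) ≤ atTop →
      ∀ z₁ z₂, (∀ w, Tendsto (fun k => inner ℝ (x k) w) l₁ (𝓝 (inner ℝ z₁ w))) →
      (∀ w, Tendsto (fun k => inner ℝ (x k) w) l₂ (𝓝 (inner ℝ z₂ w))) → z₁ = z₂ := by
    intro l₁ l₂ hl₁ hl₂ z₁ z₂ h₁ h₂
    obtain ⟨a₁, ha₁⟩ := hfejer z₁ (hcluster l₁ hl₁ z₁ h₁)
    obtain ⟨a₂, ha₂⟩ := hfejer z₂ (hcluster l₂ hl₂ z₂ h₂)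
    obtain ⟨v₁, hv₁⟩ := hlim z₁
    obtain ⟨v₂, hv₂⟩ := hlim z₂
    have hv := hv₂.sub hv₁
    set v := v₂ - v₁
    have hb : Tendsto (fun k => inner ℝ (x k) (M k z₂ - M k z₁ - v)) atTop (𝓝 0) := by
      have h0 : Tendsto (fun k => D * ‖M k z₂ - M k z₁ - v‖) atTop (𝓝 (D * 0)) :=
        (tendsto_iff_norm_sub_tendsto_zero.1 hv).const_mul D
      rw [mul_zero] at h0
      refine squeeze_zero_norm (fun k => ?_) h0
      exact (norm_inner_le_norm _ _).trans (by gcongr; exact hx k)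
    -- The quadratic terms in `x k` cancel between the two Fejér limits. Thus `⟨x k, v⟩` converges
    -- along the whole sequence, `z₁` and `z₂` pair equally with `v`, and coercivity forces `z₁ =
    -- z₂`.
    have hconv : ∃ a, Tendsto (fun k => inner ℝ (x k) v) atTop (𝓝 a) := by
      have h1 := (((ha₁.sub ha₂).sub (hv₁.inner (tendsto_const_nhds (x := z₁)))).add
        (hv₂.inner (tendsto_const_nhds (x := z₂)))).div_const 2
      refine ⟨_, (h1.sub hb).congr fun k => ?_⟩
      have e1 : inner ℝ (M k (x k)) z₁ = inner ℝ (x k) (M k z₁) := hs _ _ _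
      have e2 : inner ℝ (M k (x k)) z₂ = inner ℝ (x k) (M k z₂) := hs _ _ _
      have e3 : inner ℝ (M k z₁) (x k) = inner ℝ (x k) (M k z₁) := real_inner_comm _ _
      have e4 : inner ℝ (M k z₂) (x k) = inner ℝ (x k) (M k z₂) := real_inner_comm _ _
      simp only [map_sub, inner_sub_left, inner_sub_right, e1, e2, e3, e4]
      ring
    obtain ⟨a, ha⟩ := hconv
    have hz₁ := tendsto_nhds_unique (h₁ v) (ha.mono_left hl₁)
    have hz₂ := tendsto_nhds_unique (h₂ v) (ha.mono_left hl₂)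
    have hle : c * ‖z₂ - z₁‖ ^ 2 ≤ inner ℝ v (z₂ - z₁) := by
      refine ge_of_tendsto' (hv.inner (tendsto_const_nhds (x := z₂ - z₁))) fun k => ?_
      have := hcM k (z₂ - z₁)
      rwa [map_sub] at this
    rw [real_inner_comm, inner_sub_left, hz₁, hz₂, sub_self] at hle
    have h0 : ‖z₂ - z₁‖ = 0 := by
      have h3 : ‖z₂ - z₁‖ ^ 2 ≤ 0 := by
        by_contra hcon
        push Not at hcon
        linarith [mul_pos hc hcon]
      nlinarith [norm_nonneg (z₂ - z₁)]
    exact (sub_eq_zero.1 (norm_eq_zero.1 h0)).symm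
  obtain ⟨l₀, hl₀⟩ := Ultrafilter.exists_le (atTop : Filter ℕ)
  obtain ⟨z, hz⟩ := exists_tendsto_inner l₀ hx
  refine ⟨z, hcluster l₀ hl₀ z hz, fun w => (tendsto_iff_ultrafilter _ _ _).2 fun l hl => ?_⟩
  obtain ⟨z', hz'⟩ := exists_tendsto_inner l hx
  rw [huniq l₀ l hl₀ hl z z' hz hz']
  exact hz' w

/-- Weak-strong closedness of the optimality condition: weak limits of points `p k` at which
`∂g + ∇f` contains elements tending to zero are minimizers. -/
theorem mem_solutionSet_of_tendsto [CompleteSpace H] {f : H → ℝ} {g : H → EReal} {β : ℝ}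
    (hg : IsGammaZero g) (hf : Differentiable ℝ f) (hβ : 0 < β)
    (hconv : ConvexOn ℝ Set.univ f)
    (hlip : ∀ x y : H, ‖gradient f x - gradient f y‖ ≤ 1 / β * ‖x - y‖)
    {ι : Type*} {l : Filter ι} [l.NeBot] {p u : ι → H} {D : ℝ}
    (hu : ∀ k, IsSubgradient g (p k) (u k)) (hD : ∀ k, ‖p k‖ ≤ D)
    (h0 : Tendsto (fun k => u k + gradient f (p k)) l (𝓝 0)) {z : H}
    (hz : ∀ w, Tendsto (fun k => inner ℝ (p k) w) l (𝓝 (inner ℝ z w))) :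
    z ∈ solutionSet f g := by
  have key : ∀ y, g y ≠ ⊤ → ∀ ε > 0, g z ≤ ((f y + (g y).toReal + ε - f z : ℝ) : EReal) := by
    intro y hy ε hε
    -- A level set of `f + g`, closed and convex, hence weakly closed; the subgradient inequalities
    -- put `p k` in it eventually.
    set S : Set H := {w | g w ≤ ((f y + (g y).toReal + ε - f w : ℝ) : EReal)} with hS
    have hmemS : ∀ w, w ∈ S ↔ g w ≠ ⊤ ∧ f w + (g w).toReal ≤ f y + (g y).toReal + ε := by
      intro w
      constructor
      · intro h
        have h1 : g w ≠ ⊤ := ne_top_of_le_ne_top (EReal.coe_ne_top _) h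
        refine ⟨h1, ?_⟩
        simp only [hS, Set.mem_ofPred_eq] at h
        rw [← hg.coe_toReal h1, EReal.coe_le_coe_iff] at h
        linarith
      · rintro ⟨h1, h2⟩
        simp only [hS, Set.mem_ofPred_eq]
        rw [← hg.coe_toReal h1, EReal.coe_le_coe_iff]
        linarith
    have hSc : IsClosed S := hg.isClosed_le (continuous_const.sub hf.continuous)
    have hSconv : Convex ℝ S := by
      intro a ha b hb s t hs ht hst
      rw [hmemS] at ha hb ⊢
      obtain ⟨h1, h2⟩ := hg.combo_le ha.1 hb.1 hs ht hst
      refine ⟨h1, ?_⟩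
      have h3 := hconv.2 (Set.mem_univ a) (Set.mem_univ b) hs ht hst
      rw [smul_eq_mul, smul_eq_mul] at h3
      have h4 := mul_le_mul_of_nonneg_left ha.2 hs
      have h5 := mul_le_mul_of_nonneg_left hb.2 ht
      have h6 : s * (f y + (g y).toReal + ε) + t * (f y + (g y).toReal + ε)
          = f y + (g y).toReal + ε := by rw [← add_mul, hst, one_mul]
      linarith
    refine mem_of_tendsto_inner hSconv hSc ?_ hz
    have h1 : Tendsto (fun k => ‖u k + gradient f (p k)‖ * (‖y‖ + D)) l (𝓝 (0 * (‖y‖ + D))) := by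
      refine Tendsto.mul_const _ ?_
      simpa using h0.norm
    rw [zero_mul] at h1
    filter_upwards [h1.eventually (gt_mem_nhds hε)] with k hk
    rw [hmemS]
    refine ⟨(hu k).ne_top, ?_⟩
    have h2 := (hu k).le y hy
    have h3 := add_inner_gradient_le hf hβ hconv hlip (p k) y
    have h4 : -(‖u k + gradient f (p k)‖ * (‖y‖ + D)) ≤
        inner ℝ (u k + gradient f (p k)) (y - p k) := by
      refine (abs_le.1 ((abs_real_inner_le_norm _ _).trans ?_)).1
      gcongr
      exact (norm_sub_le _ _).trans (by linarith [hD k])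
    rw [inner_add_left] at h4
    linarith
  intro y
  by_cases hy : g y = ⊤
  · rw [hy, EReal.coe_add_top]; exact le_top
  · have hzt : g z ≠ ⊤ := ne_top_of_le_ne_top (EReal.coe_ne_top _) (key y hy 1 one_pos)
    rw [← hg.coe_toReal hy, ← hg.coe_toReal hzt, ← EReal.coe_add, ← EReal.coe_add,
      EReal.coe_le_coe_iff]
    refine le_of_forall_pos_le_add fun ε hε => ?_
    have := key y hy ε hε
    rw [← hg.coe_toReal hzt, EReal.coe_le_coe_iff] at this
    linarith

end Weak

end VMFB

noncomputable section

namespace VMFB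

/-! ### Estimates for the forward-backward residual. -/

section ForwardBackward

variable {H : Type*} [NormedAddCommGroup H] [InnerProductSpace ℝ H] [CompleteSpace H]
  {f : H → ℝ} {g : H → EReal} {α β γ : ℝ} {U : H →L[ℝ] H}

/-- The composite problem: `g ∈ Γ₀(H)` and `f` convex with `1/β`-Lipschitz gradient. -/
structure IsProblem (f : H → ℝ) (g : H → EReal) (β : ℝ) : Prop where
  gammaZero : IsGammaZero g
  convex : ConvexOn ℝ Set.univ f
  diff : Differentiable ℝ f
  pos : 0 < β
  lip : ∀ x y : H, ‖gradient f x - gradient f y‖ ≤ 1 / β * ‖x - y‖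

/-- The residual `x - prox_{γ g}^{U⁻¹}(x - γ U ∇f(x))` of the forward-backward operator. -/
def residual (f : H → ℝ) (g : H → EReal) (U : H →L[ℝ] H) (γ : ℝ) (x : H) : H :=
  x - proxInv U γ g (x - γ • U (gradient f x))

/-- The excess of the residual at `x` over the averagedness inequality relative to `z`. -/
def excess (f : H → ℝ) (g : H → EReal) (β : ℝ) (U : H →L[ℝ] H) (γ : ℝ) (z x : H) : ℝ :=
  inner ℝ (Ring.inverse U (residual f g U γ x)) (x - z) - (1 - γ * ‖U‖ / (4 * β)) *
    inner ℝ (Ring.inverse U (residual f g U γ x)) (residual f g U γ x)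

theorem IsProblem.isSubgradient_proxInv (P : IsProblem f g β) (hα : 0 < α) (hU : IsPAlpha α U)
    (hγ : 0 < γ) (y : H) : IsSubgradient g (proxInv U γ g y)
      (γ⁻¹ • Ring.inverse U (y - proxInv U γ g y)) :=
  P.gammaZero.isSubgradient_prox (hU.inverse_isMetric hα) hγ y

/-- The prox optimality condition with `U⁻¹U` cancelled. Monotonicity of `∂g` on these inclusions
yields the residual estimates. -/
theorem IsProblem.isSubgradient_residual (P : IsProblem f g β) (hα : 0 < α) (hU : IsPAlpha α U)
    (hγ : 0 < γ) (x : H) : IsSubgradient g (x - residual f g U γ x)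
      (γ⁻¹ • Ring.inverse U (residual f g U γ x) - gradient f x) := by
  have h := P.isSubgradient_proxInv hα hU hγ (x - γ • U (gradient f x))
  have e1 : x - residual f g U γ x = proxInv U γ g (x - γ • U (gradient f x)) := by
    simp [residual]
  have e2 : γ⁻¹ • Ring.inverse U (x - γ • U (gradient f x) -
      proxInv U γ g (x - γ • U (gradient f x))) =
      γ⁻¹ • Ring.inverse U (residual f g U γ x) - gradient f x := by
    rw [sub_right_comm, map_sub, map_smul, hU.inverse_apply hα, smul_sub, inv_smul_smul₀ hγ.ne']
    rfl
  rw [e1, ← e2]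
  exact h

theorem IsProblem.residual_monotone (P : IsProblem f g β) (hα : 0 < α) (hU : IsPAlpha α U)
    (hγ : 0 < γ) (x y : H) :
    0 ≤ inner ℝ (γ⁻¹ • Ring.inverse U (residual f g U γ x - residual f g U γ y)
      - (gradient f x - gradient f y)) ((x - y) - (residual f g U γ x - residual f g U γ y)) := by
  have h := (P.isSubgradient_residual hα hU hγ x).monotone (P.isSubgradient_residual hα hU hγ y)
  convert h using 2
  · rw [map_sub, smul_sub]; abel
  · abel

/-- At a minimizer `-∇f z ∈ ∂g(z)` is used directly, so no fixed point property of the prox is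
needed. -/
theorem IsProblem.residual_monotone_solution (P : IsProblem f g β) (hα : 0 < α)
    (hU : IsPAlpha α U) (hγ : 0 < γ) {z : H} (hz : z ∈ solutionSet f g) (x : H) :
    0 ≤ inner ℝ (γ⁻¹ • Ring.inverse U (residual f g U γ x)
      - (gradient f x - gradient f z)) ((x - z) - residual f g U γ x) := by
  have h := (P.isSubgradient_residual hα hU hγ x).monotone
    (isSubgradient_of_mem_solutionSet P.gammaZero P.diff P.pos P.lip hz)
  convert h using 2 <;> abel

theorem IsProblem.cocoercive (P : IsProblem f g β) (x y : H) :
    β * ‖gradient f x - gradient f y‖ ^ 2 ≤ inner ℝ (gradient f x - gradient f y) (x - y) :=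
  cocoercive_gradient P.diff P.pos P.convex P.lip x y

theorem averaged_of_monotone (hβ : 0 < β) (hα : 0 < α) (hU : IsPAlpha α U) (hγ : 0 < γ)
    {r d b : H} (hmon : 0 ≤ inner ℝ (γ⁻¹ • Ring.inverse U r - b) (d - r))
    (hcoc : β * ‖b‖ ^ 2 ≤ inner ℝ b d) :
    (1 - γ * ‖U‖ / (4 * β)) * inner ℝ (Ring.inverse U r) r ≤ inner ℝ (Ring.inverse U r) d := by
  have h := excess_eq (Ring.inverse U) (ω := ‖U‖) hγ.ne' hβ.ne' r d b
  have t1 := mul_nonneg hγ.le hmon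
  have t2 := mul_nonneg hγ.le (sub_nonneg.2 hcoc)
  have t3 : 0 ≤ γ * β * ‖b - (2 * β)⁻¹ • r‖ ^ 2 := by positivity
  have t4 : 0 ≤ γ / (4 * β) * (‖U‖ * inner ℝ (Ring.inverse U r) r - ‖r‖ ^ 2) :=
    mul_nonneg (by positivity) (sub_nonneg.2 (hU.norm_sq_le hα r))
  linarith

/-- For `γ‖U‖ < 2β` the averagedness coefficient is at least `1/2`. Keeping `r, d, b` abstract
covers both two arbitrary points and a point against a minimizer. -/
theorem norm_le_of_monotone (hβ : 0 < β) (hα : 0 < α) (hU : IsPAlpha α U) (hγ : 0 < γ)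
    (hγU : γ * ‖U‖ < 2 * β) {r d b : H}
    (hmon : 0 ≤ inner ℝ (γ⁻¹ • Ring.inverse U r - b) (d - r))
    (hcoc : β * ‖b‖ ^ 2 ≤ inner ℝ b d) : ‖r‖ ≤ 2 * ‖U‖ / α * ‖d‖ := by
  have h := averaged_of_monotone hβ hα hU hγ hmon hcoc
  have h0 := (hU.inverse_isMetric hα).nonneg r
  have h1 : γ * ‖U‖ / (4 * β) ≤ 1 / 2 := by
    rw [div_le_iff₀ (by positivity)]; linarith
  have h2 : 1 / 2 * inner ℝ (Ring.inverse U r) r ≤ ‖r‖ * ‖d‖ / α := by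
    refine le_trans ?_ (h.trans (hU.inner_inverse_le hα r d))
    gcongr
    linarith
  have h3 := mul_le_mul_of_nonneg_left h2 (norm_nonneg U)
  have h4 := hU.norm_sq_le hα r
  have h5 : ‖r‖ * ‖r‖ ≤ 2 * ‖U‖ / α * ‖d‖ * ‖r‖ := by
    calc ‖r‖ * ‖r‖ ≤ 2 * (‖U‖ * (‖r‖ * ‖d‖ / α)) := by nlinarith
      _ = _ := by ring
  rcases (norm_nonneg r).eq_or_lt with h6 | h6
  · rw [← h6]; positivity
  · exact le_of_mul_le_mul_right h5 h6

theorem IsProblem.norm_residual_sub_le (P : IsProblem f g β) (hα : 0 < α) (hU : IsPAlpha α U)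
    (hγ : 0 < γ) (hγU : γ * ‖U‖ < 2 * β) (x y : H) :
    ‖residual f g U γ x - residual f g U γ y‖ ≤ 2 * ‖U‖ / α * ‖x - y‖ :=
  norm_le_of_monotone P.pos hα hU hγ hγU (P.residual_monotone hα hU hγ x y) (P.cocoercive x y)

theorem IsProblem.norm_residual_le (P : IsProblem f g β) (hα : 0 < α) (hU : IsPAlpha α U)
    (hγ : 0 < γ) (hγU : γ * ‖U‖ < 2 * β) {z : H} (hz : z ∈ solutionSet f g) (x : H) :
    ‖residual f g U γ x‖ ≤ 2 * ‖U‖ / α * ‖x - z‖ :=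
  norm_le_of_monotone P.pos hα hU hγ hγU (P.residual_monotone_solution hα hU hγ hz x)
    (P.cocoercive x z)

theorem IsProblem.excess_nonneg (P : IsProblem f g β) (hα : 0 < α) (hU : IsPAlpha α U)
    (hγ : 0 < γ) {z : H} (hz : z ∈ solutionSet f g) (x : H) : 0 ≤ excess f g β U γ z x :=
  sub_nonneg.2 (averaged_of_monotone P.pos hα hU hγ
    (P.residual_monotone_solution hα hU hγ hz x) (P.cocoercive x z))

/-- Residuals at one point for two metrics and step sizes are comparable. -/
theorem IsProblem.norm_residual_le_of_metric (P : IsProblem f g β) (hα : 0 < α)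
    (hU : IsPAlpha α U) (hγ : 0 < γ) {V : H →L[ℝ] H} {δ : ℝ} (hV : IsPAlpha α V) (hδ : 0 < δ)
    (x : H) : ‖residual f g V δ x‖ ≤ (‖V‖ + δ * ‖V‖ / γ) / α * ‖residual f g U γ x‖ := by
  have h := (P.isSubgradient_residual hα hU hγ x).monotone (P.isSubgradient_residual hα hV hδ x)
  set v := residual f g U γ x
  set w := residual f g V δ x
  -- Both inclusions are taken at the same `x`, so the gradients cancel and monotonicity compares
  -- only `v` and `w`.
  have e1 : γ⁻¹ • Ring.inverse U v - gradient f x - (δ⁻¹ • Ring.inverse V w - gradient f x)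
      = γ⁻¹ • Ring.inverse U v - δ⁻¹ • Ring.inverse V w := by abel
  have e2 : x - v - (x - w) = w - v := by abel
  rw [e1, e2, inner_sub_left, inner_sub_right, inner_sub_right, inner_smul_left, inner_smul_left,
    inner_smul_left, inner_smul_left] at h
  simp only [RCLike.conj_to_real] at h
  have h1 := hU.inner_inverse_le hα v w
  have h2 := hV.inner_inverse_le hα w v
  have h3 := (hU.inverse_isMetric hα).nonneg v
  have h4 : δ⁻¹ * inner ℝ (Ring.inverse V w) w ≤ γ⁻¹ * (‖v‖ * ‖w‖ / α) + δ⁻¹ * (‖w‖ * ‖v‖ / α) := by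
    have := mul_le_mul_of_nonneg_left h1 (inv_nonneg.2 hγ.le)
    have := mul_le_mul_of_nonneg_left h2 (inv_nonneg.2 hδ.le)
    have := mul_nonneg (inv_nonneg.2 hγ.le) h3
    linarith
  have h5 : ‖w‖ * ‖w‖ ≤ (‖V‖ + δ * ‖V‖ / γ) / α * ‖v‖ * ‖w‖ := by
    calc ‖w‖ * ‖w‖ ≤ ‖V‖ * δ * (δ⁻¹ * inner ℝ (Ring.inverse V w) w) := by
          have := hV.norm_sq_le hα w
          rw [mul_assoc, mul_inv_cancel_left₀ hδ.ne']
          nlinarith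
      _ ≤ ‖V‖ * δ * (γ⁻¹ * (‖v‖ * ‖w‖ / α) + δ⁻¹ * (‖w‖ * ‖v‖ / α)) := by gcongr
      _ = _ := by field_simp; ring
  rcases (norm_nonneg w).eq_or_lt with h6 | h6
  · rw [← h6]; positivity
  · exact le_of_mul_le_mul_right h5 h6

/-- Converts an error in the gradient into an additive error after the prox. -/
theorem IsProblem.norm_proxInv_sub_le (P : IsProblem f g β) (hα : 0 < α) (hU : IsPAlpha α U)
    (hγ : 0 < γ) (x b : H) :
    ‖proxInv U γ g (x - γ • U b) - proxInv U γ g x‖ ≤ γ * ‖U‖ * ‖b‖ := by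
  have h := (P.isSubgradient_proxInv hα hU hγ (x - γ • U b)).monotone
    (P.isSubgradient_proxInv hα hU hγ x)
  set p := proxInv U γ g (x - γ • U b)
  set q := proxInv U γ g x
  have e : γ⁻¹ • Ring.inverse U (x - γ • U b - p) - γ⁻¹ • Ring.inverse U (x - q)
      = -b - γ⁻¹ • Ring.inverse U (p - q) := by
    rw [← smul_sub, ← map_sub]
    have : x - γ • U b - p - (x - q) = -(γ • U b) - (p - q) := by abel
    rw [this, map_sub, map_neg, map_smul, hU.inverse_apply hα, smul_sub, smul_neg,
      inv_smul_smul₀ hγ.ne']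
  rw [e, inner_sub_left, inner_neg_left, inner_smul_left, RCLike.conj_to_real] at h
  have h1 := hU.norm_sq_le hα (p - q)
  have h2 := (abs_le.1 (abs_real_inner_le_norm b (p - q))).1
  have h3 : inner ℝ (Ring.inverse U (p - q)) (p - q) ≤ γ * (‖b‖ * ‖p - q‖) := by
    rw [← inv_mul_le_iff₀ hγ]; linarith
  have h4 : ‖p - q‖ * ‖p - q‖ ≤ γ * ‖U‖ * ‖b‖ * ‖p - q‖ := by
    have := mul_le_mul_of_nonneg_left h3 (norm_nonneg U)
    nlinarith
  rcases (norm_nonneg (p - q)).eq_or_lt with h6 | h6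
  · rw [← h6]; positivity
  · exact le_of_mul_le_mul_right h4 h6

theorem inner_sub_smul_residual (hα : 0 < α) (hU : IsPAlpha α U) (lam : ℝ) (z x : H) :
    inner ℝ (Ring.inverse U ((x - z) - lam • residual f g U γ x))
        ((x - z) - lam • residual f g U γ x) =
      inner ℝ (Ring.inverse U (x - z)) (x - z) - lam * (2 * excess f g β U γ z x +
        (2 - γ * ‖U‖ / (2 * β) - lam) *
          inner ℝ (Ring.inverse U (residual f g U γ x)) (residual f g U γ x)) := by
  have hM := hU.inverse_isMetric hα
  have e : (x - z) - lam • residual f g U γ x = (x - z) + (-lam) • residual f g U γ x := by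
    module
  rw [e, hM.inner_add_self, map_smul, inner_smul_right, inner_smul_right, inner_smul_left,
    RCLike.conj_to_real, excess, hM.inner_comm (x - z) (residual f g U γ x)]
  ring

end ForwardBackward

/-! ### Asymptotics of the perturbed iteration. -/

section Iteration

variable {H : Type*} [NormedAddCommGroup H] [InnerProductSpace ℝ H] [CompleteSpace H]
  {f : H → ℝ} {g : H → EReal} {α β μ : ℝ} {η γ lam e : ℕ → ℝ} {U : ℕ → H →L[ℝ] H} {x : ℕ → H}

/-- The parameters and iterates of the relaxed variable metric forward-backward method, where the
errors are only recorded through a summable bound `e`. -/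
structure IsIteration (f : H → ℝ) (g : H → EReal) (α β μ : ℝ) (η γ lam e : ℕ → ℝ)
    (U : ℕ → H →L[ℝ] H) (x : ℕ → H) : Prop where
  problem : IsProblem f g β
  alpha_pos : 0 < α
  eta_nonneg : ∀ k, 0 ≤ η k
  eta_summable : Summable η
  metric : ∀ k, IsPAlpha α (U k)
  norm_le : ∀ k, ‖U k‖ ≤ μ
  mono : ∀ k, U k ≤ (1 + η k) • U (k + 1)
  gamma_pos : ∀ k, 0 < γ k
  gamma_lt : ∀ k, γ k * ‖U k‖ < 2 * β
  lam_pos : ∀ k, 0 < lam k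
  lam_lt : ∀ k, lam k < 2 - γ k * ‖U k‖ / (2 * β)
  error_summable : Summable e
  step : ∀ k, ‖x (k + 1) - (x k - lam k • residual f g (U k) (γ k) (x k))‖ ≤ e k

theorem IsIteration.error_nonneg (I : IsIteration f g α β μ η γ lam e U x) (k : ℕ) : 0 ≤ e k :=
  (norm_nonneg _).trans (I.step k)

theorem IsIteration.norm_sq_le (I : IsIteration f g α β μ η γ lam e U x) (k : ℕ) (w : H) :
    ‖w‖ ^ 2 ≤ μ * inner ℝ (Ring.inverse (U k) w) w :=
  ((I.metric k).norm_sq_le I.alpha_pos w).trans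
    (mul_le_mul_of_nonneg_right (I.norm_le k)
      (((I.metric k).inverse_isMetric I.alpha_pos).nonneg w))

theorem IsIteration.bound_nonneg (I : IsIteration f g α β μ η γ lam e U x) : 0 ≤ μ :=
  (norm_nonneg _).trans (I.norm_le 0)

theorem IsIteration.lam_le (I : IsIteration f g α β μ η γ lam e U x) (k : ℕ) : lam k ≤ 2 := by
  have := I.problem.pos
  have h1 : 0 ≤ γ k * ‖U k‖ / (2 * β) :=
    div_nonneg (mul_nonneg (I.gamma_pos k).le (norm_nonneg _)) (by positivity)
  linarith [I.lam_lt k]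

/-- The exact step decreases the squared distance by the summand below, the error adds at most `e k
/ √α` in the metric norm, and the new metric costs a factor `1 + η k` on squares. -/
theorem IsIteration.fejer (I : IsIteration f g α β μ η γ lam e U x) {z : H}
    (hz : z ∈ solutionSet f g) :
    (∃ l, Tendsto (fun k => metricNorm (Ring.inverse (U k)) (x k - z)) atTop (𝓝 l)) ∧
    (∃ D, ∀ k, ‖x k - z‖ ≤ D) ∧
    Summable fun k => lam k * (2 * excess f g β (U k) (γ k) z (x k) +
      (2 - γ k * ‖U k‖ / (2 * β) - lam k) * inner ℝ (Ring.inverse (U k)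
        (residual f g (U k) (γ k) (x k))) (residual f g (U k) (γ k) (x k))) := by
  have hα := I.alpha_pos
  have hM := fun k => (I.metric k).inverse_isMetric hα
  set s := fun k => metricNorm (Ring.inverse (U k)) (x k - z) with hs
  set A := fun k => metricNorm (Ring.inverse (U k))
    ((x k - z) - lam k • residual f g (U k) (γ k) (x k)) with hA
  set Δ := fun k => lam k * (2 * excess f g β (U k) (γ k) z (x k) +
      (2 - γ k * ‖U k‖ / (2 * β) - lam k) * inner ℝ (Ring.inverse (U k)
        (residual f g (U k) (γ k) (x k))) (residual f g (U k) (γ k) (x k))) with hΔ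
  have hs0 : ∀ k, 0 ≤ s k := fun k => metricNorm_nonneg _ _
  have hA0 : ∀ k, 0 ≤ A k := fun k => metricNorm_nonneg _ _
  have hΔ0 : ∀ k, 0 ≤ Δ k := fun k => by
    have h1 := I.problem.excess_nonneg hα (I.metric k) (I.gamma_pos k) hz (x k)
    have h2 := mul_nonneg (sub_nonneg.2 (I.lam_lt k).le)
      ((hM k).nonneg (residual f g (U k) (γ k) (x k)))
    exact mul_nonneg (I.lam_pos k).le (by linarith)
  have hAs : ∀ k, A k ^ 2 = s k ^ 2 - Δ k := fun k => by
    simp only [hA, hs, hΔ]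
    rw [(hM k).metricNorm_sq, (hM k).metricNorm_sq]
    exact inner_sub_smul_residual hα (I.metric k) (lam k) z (x k)
  have hε0 : ∀ k, 0 ≤ e k / √α := fun k => div_nonneg (I.error_nonneg k) (Real.sqrt_nonneg _)
  have hεs : Summable fun k => e k / √α := I.error_summable.div_const _
  have hnorm : ∀ k w, metricNorm (Ring.inverse (U k)) w ≤ ‖w‖ / √α := fun k w => by
    rw [metricNorm, ← Real.sqrt_sq (norm_nonneg w), ← Real.sqrt_div (sq_nonneg _)]
    apply Real.sqrt_le_sqrt
    rw [sq]
    exact (I.metric k).inner_inverse_le hα w w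
  have hstep : ∀ k, s (k + 1) ^ 2 ≤ (1 + η k) * (A k + e k / √α) ^ 2 := fun k => by
    have h1 := inner_inverse_le_of_le hα (I.metric k) (I.metric (k + 1)) (I.mono k)
      (x (k + 1) - z)
    rw [← (hM _).metricNorm_sq, ← (hM _).metricNorm_sq] at h1
    refine h1.trans (mul_le_mul_of_nonneg_left ?_ (by linarith [I.eta_nonneg k]))
    refine pow_le_pow_left₀ (metricNorm_nonneg _ _) ?_ 2
    have e1 : x (k + 1) - z = ((x k - z) - lam k • residual f g (U k) (γ k) (x k))
        + (x (k + 1) - (x k - lam k • residual f g (U k) (γ k) (x k))) := by abel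
    rw [e1]
    refine ((hM k).metricNorm_add_le _ _).trans (add_le_add le_rfl ((hnorm k _).trans ?_))
    gcongr
    exact I.step k
  have hAle : ∀ k, A k ≤ s k := fun k =>
    (abs_le_of_sq_le_sq' (by rw [hAs]; linarith [hΔ0 k]) (hs0 k)).2
  obtain ⟨l, hl⟩ := exists_tendsto_of_le_one_add_mul_add hs0 I.eta_nonneg I.eta_summable hε0 hεs
    fun k => by
      have hη := I.eta_nonneg k
      have hnn : 0 ≤ s k + e k / √α := add_nonneg (hs0 k) (hε0 k)
      -- Unsquaring uses `1 + η k ≤ (1 + η k)²`.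
      refine (abs_le_of_sq_le_sq' ?_ (mul_nonneg (by linarith) hnn)).2
      refine (hstep k).trans ?_
      have h1 : (A k + e k / √α) ^ 2 ≤ (s k + e k / √α) ^ 2 :=
        pow_le_pow_left₀ (add_nonneg (hA0 k) (hε0 k)) (by linarith [hAle k]) 2
      rw [mul_pow]
      refine mul_le_mul (by nlinarith) h1 (sq_nonneg _) (sq_nonneg _)
  obtain ⟨S, hS⟩ := hl.bddAbove_range
  have hS' : ∀ k, s k ≤ S := fun k => hS ⟨k, rfl⟩
  refine ⟨⟨l, hl⟩, ⟨√(μ * S ^ 2), fun k => ?_⟩, ?_⟩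
  · apply Real.le_sqrt_of_sq_le
    refine (I.norm_sq_le k _).trans (mul_le_mul_of_nonneg_left ?_ I.bound_nonneg)
    rw [← (hM k).metricNorm_sq]
    exact pow_le_pow_left₀ (hs0 k) (hS' k) 2
  · exact summable_of_quasiFejer hs0 hA0 I.eta_nonneg I.eta_summable hε0 hεs hΔ0
      (fun k => (hAs k).le) hstep hS'

theorem IsIteration.tendsto_residual_of_gap (I : IsIteration f g α β μ η γ lam e U x)
    (hΩ : (solutionSet f g).Nonempty) {lamLow τ : ℝ} (hlamLow : 0 < lamLow) (hτ : 0 < τ)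
    (hlow : ∀ k, lamLow ≤ lam k) (hup : ∀ k, lam k ≤ 2 - γ k * ‖U k‖ / (2 * β) - τ) :
    Tendsto (fun k => ‖residual f g (U k) (γ k) (x k)‖) atTop (𝓝 0) := by
  obtain ⟨z, hz⟩ := hΩ
  obtain ⟨-, -, hsum⟩ := I.fejer hz
  set m := fun k => inner ℝ (Ring.inverse (U k)
        (residual f g (U k) (γ k) (x k))) (residual f g (U k) (γ k) (x k)) with hm
  have hm0 : ∀ k, 0 ≤ m k := fun k => ((I.metric k).inverse_isMetric I.alpha_pos).nonneg _
  have hle : ∀ k, ‖residual f g (U k) (γ k) (x k)‖ ≤ √(μ * ((lamLow * τ)⁻¹ * (lam k *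
      (2 * excess f g β (U k) (γ k) z (x k) +
        (2 - γ k * ‖U k‖ / (2 * β) - lam k) * m k)))) := fun k => by
    apply Real.le_sqrt_of_sq_le
    refine (I.norm_sq_le k _).trans (mul_le_mul_of_nonneg_left ?_ I.bound_nonneg)
    rw [le_inv_mul_iff₀ (by positivity), mul_assoc]
    have h1 := I.problem.excess_nonneg I.alpha_pos (I.metric k) (I.gamma_pos k) hz (x k)
    refine mul_le_mul (hlow k) ?_ (mul_nonneg hτ.le (hm0 k)) (I.lam_pos k).le
    have h2 : τ * m k ≤ (2 - γ k * ‖U k‖ / (2 * β) - lam k) * m k :=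
      mul_le_mul_of_nonneg_right (by linarith [hup k]) (hm0 k)
    linarith
  have hlim := (Real.continuous_sqrt.tendsto _).comp
    ((hsum.tendsto_atTop_zero.const_mul (lamLow * τ)⁻¹).const_mul μ)
  simp only [mul_zero, Real.sqrt_zero] at hlim
  exact squeeze_zero (fun k => norm_nonneg _) hle hlim

theorem IsIteration.tendsto_residual_of_divergence (I : IsIteration f g α β μ η γ lam e U x)
    (hΩ : (solutionSet f g).Nonempty) {γLow ε : ℝ} (hγLow : 0 < γLow) (hε : 0 < ε)
    (hγ : ∀ k, γLow ≤ γ k) (hγμ : ∀ k, γ k * μ ≤ 2 * β - ε) (hdiv : ¬ Summable lam) :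
    Tendsto (fun k => ‖residual f g (U k) (γ k) (x k)‖) atTop (𝓝 0) := by
  obtain ⟨z, hz⟩ := hΩ
  obtain ⟨-, ⟨D₀, hD₀⟩, hsum⟩ := I.fejer hz
  have hα := I.alpha_pos
  have hβ := I.problem.pos
  have hμ := I.bound_nonneg
  have hD₀0 : 0 ≤ D₀ := (norm_nonneg _).trans (hD₀ 0)
  set D := max D₀ (2 * μ / α * D₀)
  have hrD : ∀ k, ‖residual f g (U k) (γ k) (x k)‖ ≤ 2 * μ / α * D₀ := fun k => by
    refine (I.problem.norm_residual_le hα (I.metric k) (I.gamma_pos k) (I.gamma_lt k) hz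
      (x k)).trans ?_
    have := I.norm_le k
    have := hD₀ k
    gcongr
  set X := fun k => excess f g β (U k) (γ k) z (x k) with hX
  set K₁ := 4 * β * D / √(γLow * β) + D * √(8 * β ^ 2 / (α * γLow ^ 2)) with hK₁
  set K₂ := 4 * β / γLow with hK₂
  have hK₁0 : 0 ≤ K₁ := by
    have : 0 ≤ D := hD₀0.trans (le_max_left _ _)
    positivity
  have hK₂0 : 0 < K₂ := by positivity
  have hbound : ∀ k, 0 ≤ X k ∧ ε / (4 * β) * ‖residual f g (U k) (γ k) (x k)‖ ^ 2 ≤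
      K₁ * √(X k) + K₂ * X k := fun k => by
    refine residual_sq_le hγLow (hγ k) hβ hα (norm_nonneg (U k)) hε ?_
      (I.problem.residual_monotone_solution hα (I.metric k) (I.gamma_pos k) hz (x k))
      (I.problem.cocoercive (x k) z) ((I.metric k).norm_sq_le hα _)
      ((I.metric k).norm_sub_sq_le hα _) ((hrD k).trans (le_max_right _ _))
      ((hD₀ k).trans (le_max_left _ _)) rfl
    exact (mul_le_mul_of_nonneg_left (I.norm_le k) (I.gamma_pos k).le).trans (hγμ k)
  refine tendsto_zero_of_summable_excursions (X := X) (Λ := 2) (x := x)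
    (C := (μ + 2 * β / γLow) / α) (C' := 2 * μ / α)
    (fun k => norm_nonneg _) hrD (fun k => (I.lam_pos k).le) I.lam_le (by positivity)
    (by positivity) (fun k => (hbound k).1) I.error_nonneg I.error_summable ?_ hdiv ?_ ?_ ?_
  · refine Summable.of_nonneg_of_le (fun k => mul_nonneg (I.lam_pos k).le (hbound k).1)
      (fun k => mul_le_mul_of_nonneg_left ?_ (I.lam_pos k).le) hsum
    have h2 := mul_nonneg (sub_nonneg.2 (I.lam_lt k).le)
      (((I.metric k).inverse_isMetric hα).nonneg (residual f g (U k) (γ k) (x k)))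
    have h3 := (hbound k).1
    change X k ≤ 2 * X k + _
    linarith
  -- The bound `K₁√X + K₂X` vanishes continuously at `0`, so a residual of size `t` keeps `X` away
  -- from `0`.
  · intro t ht
    have hcont : Tendsto (fun y : ℝ => K₁ * √y + K₂ * y) (𝓝 0) (𝓝 (K₁ * √0 + K₂ * 0)) :=
      ((Real.continuous_sqrt.const_mul _).add (continuous_const_mul K₂)).tendsto 0
    simp only [Real.sqrt_zero, mul_zero, add_zero] at hcont
    have hpos : 0 < ε / (4 * β) * t ^ 2 := by positivity
    obtain ⟨c, hc, hcX⟩ := Metric.eventually_nhds_iff.1 (hcont.eventually (gt_mem_nhds hpos))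
    refine ⟨c, hc, fun k hk => ?_⟩
    by_contra hlt
    push Not at hlt
    have h1 := hcX (y := X k) (by
      rw [Real.dist_eq, sub_zero, abs_of_nonneg (hbound k).1]; exact hlt)
    have h2 : ε / (4 * β) * t ^ 2 ≤ ε / (4 * β) * ‖residual f g (U k) (γ k) (x k)‖ ^ 2 := by
      gcongr
    exact absurd (h2.trans (hbound k).2) (not_le.2 h1)
  · intro k
    have e1 : x (k + 1) - x k = (x (k + 1) - (x k - lam k • residual f g (U k) (γ k) (x k)))
        - lam k • residual f g (U k) (γ k) (x k) := by abel
    rw [e1]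
    refine (norm_sub_le _ _).trans ?_
    rw [norm_smul, Real.norm_of_nonneg (I.lam_pos k).le]
    linarith [I.step k]
  -- Compare at the point `x m`: first move from `x k` to `x m` with metric `k` fixed, then change
  -- metric and step size from `k` to `m`.
  · intro m k
    have h1 := I.problem.norm_residual_sub_le hα (I.metric k) (I.gamma_pos k) (I.gamma_lt k)
      (x k) (x m)
    have h2 := I.problem.norm_residual_le_of_metric hα (I.metric m) (I.gamma_pos m)
      (I.metric k) (I.gamma_pos k) (x m)
    have h3 : 2 * ‖U k‖ / α * ‖x k - x m‖ ≤ 2 * μ / α * ‖x k - x m‖ := by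
      have := I.norm_le k
      gcongr
    have h4 : (‖U k‖ + γ k * ‖U k‖ / γ m) / α * ‖residual f g (U m) (γ m) (x m)‖ ≤
        (μ + 2 * β / γLow) / α * ‖residual f g (U m) (γ m) (x m)‖ := by
      have := I.norm_le k
      have := (I.gamma_lt k).le
      have := hγ m
      gcongr
    have h5 : ‖residual f g (U k) (γ k) (x k)‖ ≤
        ‖residual f g (U k) (γ k) (x k) - residual f g (U k) (γ k) (x m)‖
          + ‖residual f g (U k) (γ k) (x m)‖ := by
      simpa using norm_add_le (residual f g (U k) (γ k) (x k) - residual f g (U k) (γ k) (x m))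
        (residual f g (U k) (γ k) (x m))
    linarith

theorem IsIteration.exists_weak_limit (I : IsIteration f g α β μ η γ lam e U x)
    (hΩ : (solutionSet f g).Nonempty) {γLow : ℝ} (hγLow : 0 < γLow) (hγ : ∀ k, γLow ≤ γ k)
    (hr : Tendsto (fun k => ‖residual f g (U k) (γ k) (x k)‖) atTop (𝓝 0)) :
    ∃ z ∈ solutionSet f g,
      Tendsto (fun k => toWeakSpace ℝ H (x k)) atTop (𝓝 (toWeakSpace ℝ H z)) := by
  have hα := I.alpha_pos
  have hβ := I.problem.pos
  have hμ := I.bound_nonneg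
  have hM := fun k => (I.metric k).inverse_isMetric hα
  obtain ⟨D, hD⟩ : ∃ D, ∀ k, ‖x k‖ ≤ D := by
    obtain ⟨z, hz⟩ := hΩ
    obtain ⟨-, ⟨D₀, hD₀⟩, -⟩ := I.fejer hz
    refine ⟨D₀ + ‖z‖, fun k => ?_⟩
    have := norm_add_le (x k - z) z
    rw [sub_add_cancel] at this
    linarith [hD₀ k]
  obtain ⟨R, hR⟩ := hr.bddAbove_range
  have hweak : ∃ z ∈ solutionSet f g, ∀ w,
      Tendsto (fun k => inner ℝ (x k) w) atTop (𝓝 (inner ℝ z w)) := by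
    refine exists_tendsto_inner_of_opial (M := fun k => Ring.inverse (U k)) (c := (μ + 1)⁻¹)
      (fun k => (hM k).symm) (by positivity) (fun k w => ?_) hD ?_ ?_ ?_
    · rw [inv_mul_le_iff₀ (by positivity)]
      linarith [I.norm_sq_le k w, (hM k).nonneg w]
    · refine exists_tendsto_apply (fun k => (hM k).symm) (fun k => (hM k).nonneg) (C := α⁻¹)
        (fun k w => ?_) I.eta_nonneg I.eta_summable
        (fun k w => inner_inverse_le_of_le hα (I.metric k) (I.metric (k + 1)) (I.mono k) w)
      exact ((I.metric k).inner_inverse_le hα w w).trans_eq (by ring)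
    · intro z hz
      obtain ⟨⟨l, hl⟩, -⟩ := I.fejer hz
      refine ⟨l ^ 2, (hl.pow 2).congr fun k => ?_⟩
      rw [(hM k).metricNorm_sq]
    · intro l hl z hz
      have hr' : Tendsto (fun k => ‖residual f g (U k) (γ k) (x k)‖) l (𝓝 0) := hr.mono_left hl
      -- Applied to `p k = x k - r k`, where `∂g + ∇f` contains `γ⁻¹U⁻¹r - (∇f x - ∇f(x - r))`, of
      -- norm `O(‖r‖)`.
      refine mem_solutionSet_of_tendsto I.problem.gammaZero I.problem.diff hβ I.problem.convex
        I.problem.lip (fun k => I.problem.isSubgradient_residual hα (I.metric k) (I.gamma_pos k)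
          (x k)) (D := D + R) (fun k => ?_) ?_ (l := (l : Filter ℕ)) fun w => ?_
      · exact (norm_sub_le _ _).trans (add_le_add (hD k) (hR ⟨k, rfl⟩))
      · have h1 := hr'.mul_const (γLow⁻¹ / α + 1 / β)
        rw [zero_mul] at h1
        refine squeeze_zero_norm (fun k => ?_) h1
        rw [sub_add]
        refine (norm_sub_le _ _).trans ?_
        have h2 := I.problem.lip (x k) (x k - residual f g (U k) (γ k) (x k))
        rw [sub_sub_cancel] at h2
        have h3 : ‖(γ k)⁻¹ • Ring.inverse (U k) (residual f g (U k) (γ k) (x k))‖ ≤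
            γLow⁻¹ * (‖residual f g (U k) (γ k) (x k)‖ / α) := by
          rw [norm_smul, norm_inv, Real.norm_of_nonneg (I.gamma_pos k).le]
          have := hγ k
          have := (I.metric k).norm_inverse_le hα (residual f g (U k) (γ k) (x k))
          gcongr
        calc _ ≤ γLow⁻¹ * (‖residual f g (U k) (γ k) (x k)‖ / α)
              + 1 / β * ‖residual f g (U k) (γ k) (x k)‖ := add_le_add h3 h2
          _ = _ := by ring
      · have h1 : Tendsto (fun k => inner ℝ (residual f g (U k) (γ k) (x k)) w) l (𝓝 0) := by
          have h2 := hr'.mul_const ‖w‖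
          rw [zero_mul] at h2
          exact squeeze_zero_norm (fun k => norm_inner_le_norm _ _) h2
        have h3 := (hz w).sub h1
        rw [sub_zero] at h3
        exact h3.congr fun k => (inner_sub_left _ _ _).symm
  obtain ⟨z, hz, hzw⟩ := hweak
  exact ⟨z, hz, tendsto_toWeakSpace hzw⟩

/-- Cocoercivity and monotonicity give `β‖b‖² ≤ ⟨b, d⟩ ≤ γ⁻¹⟨U⁻¹r, d - r⟩ + ⟨b, r⟩`, and `d` is
bounded. -/
theorem IsIteration.tendsto_gradient (I : IsIteration f g α β μ η γ lam e U x)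
    {γLow : ℝ} (hγLow : 0 < γLow) (hγ : ∀ k, γLow ≤ γ k)
    (hr : Tendsto (fun k => ‖residual f g (U k) (γ k) (x k)‖) atTop (𝓝 0))
    {z : H} (hz : z ∈ solutionSet f g) :
    Tendsto (fun k => gradient f (x k)) atTop (𝓝 (gradient f z)) := by
  have hα := I.alpha_pos
  have hβ := I.problem.pos
  obtain ⟨-, ⟨D, hD⟩, -⟩ := I.fejer hz
  obtain ⟨R, hR⟩ := hr.bddAbove_range
  have hR' : ∀ k, ‖residual f g (U k) (γ k) (x k)‖ ≤ R := fun k => hR ⟨k, rfl⟩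
  rw [tendsto_iff_norm_sub_tendsto_zero]
  set K := β⁻¹ * (γLow⁻¹ * ((D + R) / α) + 1 / β * D) with hK
  have hlim := (Real.continuous_sqrt.tendsto _).comp (hr.mul_const K)
  simp only [zero_mul, Real.sqrt_zero] at hlim
  refine squeeze_zero (fun k => norm_nonneg _) (fun k => ?_) hlim
  apply Real.le_sqrt_of_sq_le
  have h1 := I.problem.residual_monotone_solution hα (I.metric k) (I.gamma_pos k) hz (x k)
  have h2 := I.problem.cocoercive (x k) z
  have h3 := I.problem.lip (x k) z
  set r := residual f g (U k) (γ k) (x k)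
  set b := gradient f (x k) - gradient f z
  rw [inner_sub_left, inner_sub_right b, inner_smul_left, RCLike.conj_to_real] at h1
  have h4 : (γ k)⁻¹ * inner ℝ (Ring.inverse (U k) r) (x k - z - r) ≤
      γLow⁻¹ * (‖r‖ * (D + R) / α) := by
    have h5 := (I.metric k).inner_inverse_le hα r (x k - z - r)
    have h6 : ‖x k - z - r‖ ≤ D + R := (norm_sub_le _ _).trans (add_le_add (hD k) (hR' k))
    have h7 := hγ k
    have h8 := (I.gamma_pos k)
    calc _ ≤ (γ k)⁻¹ * (‖r‖ * ‖x k - z - r‖ / α) := by gcongr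
      _ ≤ γLow⁻¹ * (‖r‖ * (D + R) / α) := by gcongr
  have h5 : inner ℝ b r ≤ 1 / β * D * ‖r‖ := by
    refine (real_inner_le_norm _ _).trans ?_
    have := hD k
    have : ‖b‖ ≤ 1 / β * D := h3.trans (by gcongr)
    gcongr
  have h6 : β * ‖b‖ ^ 2 ≤ γLow⁻¹ * (‖r‖ * (D + R) / α) + 1 / β * D * ‖r‖ := by linarith
  rw [← le_inv_mul_iff₀ hβ] at h6
  exact h6.trans_eq (by rw [hK]; ring)

end Iteration

end VMFB

end

/-! ### The convergence theorem. -/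

theorem corollary3p2 {H : Type*} [NormedAddCommGroup H] [InnerProductSpace ℝ H] [CompleteSpace H]
    -- the problem: minimize `f + g`
    (g : H → EReal) (hg : VMFB.IsGammaZero g)
    (f : H → ℝ) (hf_convex : ConvexOn ℝ Set.univ f) (hf_diff : Differentiable ℝ f)
    (β : ℝ) (hβ : 0 < β)
    (hf_lip : ∀ x y : H, ‖gradient f x - gradient f y‖ ≤ 1 / β * ‖x - y‖)
    (hΩ : (VMFB.solutionSet f g).Nonempty)
    -- the metrics
    (α : ℝ) (hα : 0 < α) (η : ℕ → ℝ) (hη_nonneg : ∀ k, 0 ≤ η k) (hη_sum : Summable η)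
    (U : ℕ → H →L[ℝ] H) (hU : ∀ k, VMFB.IsPAlpha α (U k))
    (μ : ℝ) (hμ : IsLUB (Set.range fun k => ‖U k‖) μ)
    (hU_mono : ∀ k, U k ≤ (1 + η k) • U (k + 1))
    -- step sizes in `(0, 2β/‖U_k‖)`, relaxation parameters in `(0, 1/α_k)`, errors
    (γ : ℕ → ℝ) (hγ_pos : ∀ k, 0 < γ k) (hγ_lt : ∀ k, γ k * ‖U k‖ < 2 * β)
    (lam : ℕ → ℝ) (hlam_pos : ∀ k, 0 < lam k)
    (hlam_lt : ∀ k, lam k < 1 / VMFB.avgConst β (γ k) (U k))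
    (a b : ℕ → H) (ha : Summable fun k => lam k * ‖a k‖) (hb : Summable fun k => lam k * ‖b k‖)
    -- the iteration, from an arbitrary `x 0`
    (x y : ℕ → H)
    (hy : ∀ k, y k = x k - γ k • U k (gradient f (x k) + b k))
    (hx : ∀ k, x (k + 1) = x k + lam k • (VMFB.proxInv (U k) (γ k) g (y k) + a k - x k)) :
    -- (i)
    (∀ z ∈ VMFB.solutionSet f g, ∃ l : ℝ,
      Tendsto (fun k => VMFB.metricNorm (Ring.inverse (U k)) (x k - z)) atTop (𝓝 l)) ∧
    -- (ii), (iii), (iv) under the first set of conditions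
    (∀ lamLow τ : ℝ, 0 < lamLow → 0 < τ → (∀ k, lamLow ≤ lam k) →
      (∀ k, lam k ≤ 1 / VMFB.avgConst β (γ k) (U k) - τ) →
      Tendsto (fun k => ‖x k - VMFB.proxInv (U k) (γ k) g (x k - γ k • U k (gradient f (x k)))‖)
        atTop (𝓝 0) ∧
      ∀ γLow : ℝ, 0 < γLow → (∀ k, γLow ≤ γ k) →
        (∃ z ∈ VMFB.solutionSet f g,
          Tendsto (fun k => toWeakSpace ℝ H (x k)) atTop (𝓝 (toWeakSpace ℝ H z))) ∧
        ∀ ε : ℝ, 0 < ε → (∀ k, γ k * μ ≤ 2 * β - ε) →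
          ∀ z ∈ VMFB.solutionSet f g,
            Tendsto (fun k => gradient f (x k)) atTop (𝓝 (gradient f z))) ∧
    -- (ii), (iii), (iv) under the second set of conditions
    (∀ γLow ε : ℝ, 0 < γLow → 0 < ε → (∀ k, γLow ≤ γ k) → (∀ k, γ k * μ ≤ 2 * β - ε) →
      Tendsto (fun n => ∑ k ∈ Finset.range n,
        lam k * (1 / VMFB.avgConst β (γ k) (U k) - lam k)) atTop atTop →
      (Summable fun k => |γ (k + 1) - γ k|) →
      (Summable fun k => |γ (k + 1) * ‖U (k + 1)‖ - γ k * ‖U k‖|) →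
      (∀ w : H, Summable fun k => ‖Ring.inverse (U k) w - Ring.inverse (U (k + 1)) w‖) →
      Tendsto (fun k => ‖x k - VMFB.proxInv (U k) (γ k) g (x k - γ k • U k (gradient f (x k)))‖)
        atTop (𝓝 0) ∧
      (∃ z ∈ VMFB.solutionSet f g,
        Tendsto (fun k => toWeakSpace ℝ H (x k)) atTop (𝓝 (toWeakSpace ℝ H z))) ∧
      ∀ lamLow : ℝ, 0 < lamLow → (∀ k, lamLow ≤ lam k) →
        ∀ z ∈ VMFB.solutionSet f g,
          Tendsto (fun k => gradient f (x k)) atTop (𝓝 (gradient f z))) := by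
  -- The factor `2 * β` bounds `γ k * ‖U k‖`, the Lipschitz cost of passing `b k` through the prox.
  have hiter : VMFB.IsIteration f g α β μ η γ lam
      (fun k => lam k * ‖a k‖ + 2 * β * (lam k * ‖b k‖)) U x := by
    have hP : VMFB.IsProblem f g β := ⟨hg, hf_convex, hf_diff, hβ, hf_lip⟩
    refine ⟨hP, hα, hη_nonneg, hη_sum, hU, fun k => hμ.1 ⟨k, rfl⟩, hU_mono, hγ_pos, hγ_lt,
      hlam_pos, fun k => ?_, ha.add (hb.mul_left _), fun k => ?_⟩
    · rw [← VMFB.one_div_avgConst hβ]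
      exact hlam_lt k
    · set q := x k - γ k • U k (gradient f (x k)) with hq
      have hyq : y k = q - γ k • U k (b k) := by
        rw [hy, map_add, smul_add, hq]; abel
      have h1 := hP.norm_proxInv_sub_le hα (hU k) (hγ_pos k) q (b k)
      rw [← hyq] at h1
      have e : x (k + 1) - (x k - lam k • VMFB.residual f g (U k) (γ k) (x k)) =
          lam k • (a k + (VMFB.proxInv (U k) (γ k) g (y k) - VMFB.proxInv (U k) (γ k) g q)) := by
        rw [hx, VMFB.residual, ← hq]
        module
      have hl := hlam_pos k
      rw [e, norm_smul, Real.norm_of_nonneg hl.le]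
      have h2 : γ k * ‖U k‖ * ‖b k‖ ≤ 2 * β * ‖b k‖ :=
        mul_le_mul_of_nonneg_right (hγ_lt k).le (norm_nonneg _)
      calc _ ≤ lam k * (‖a k‖ + 2 * β * ‖b k‖) := by
            gcongr
            exact (norm_add_le _ _).trans (by linarith)
        _ = _ := by ring
  simp only [VMFB.one_div_avgConst hβ]
  refine ⟨fun z hz => (hiter.fejer hz).1, fun lamLow τ hlamLow hτ hlow hup => ?_,
    fun γLow ε hγLow hε hγ hγμ hdiv _ _ _ => ?_⟩
  · have hr := hiter.tendsto_residual_of_gap hΩ hlamLow hτ hlow hup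
    exact ⟨hr, fun γLow hγLow hγ => ⟨hiter.exists_weak_limit hΩ hγLow hγ hr,
      fun ε _ _ z hz => hiter.tendsto_gradient hγLow hγ hr hz⟩⟩
  -- Since `1/α_k - λ_k ≤ 2`, summable relaxation parameters would contradict the divergence.
  · have hnot : ¬ Summable lam := fun hs => by
      have hs2 : Summable fun k => lam k * (2 - γ k * ‖U k‖ / (2 * β) - lam k) := by
        refine Summable.of_nonneg_of_le (fun k => mul_nonneg (hlam_pos k).le
          (sub_nonneg.2 (hiter.lam_lt k).le)) (fun k => ?_) (hs.mul_right 2)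
        have h1 : 0 ≤ γ k * ‖U k‖ / (2 * β) :=
          div_nonneg (mul_nonneg (hγ_pos k).le (norm_nonneg _)) (by positivity)
        exact mul_le_mul_of_nonneg_left (by linarith [hlam_pos k]) (hlam_pos k).le
      exact not_tendsto_nhds_of_tendsto_atTop hdiv _ hs2.hasSum.tendsto_sum_nat
    have hr := hiter.tendsto_residual_of_divergence hΩ hγLow hε hγ hγμ hnot
    exact ⟨hr, hiter.exists_weak_limit hΩ hγLow hγ hr,
      fun _ _ _ z hz => hiter.tendsto_gradient hγLow hγ hr hz⟩
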